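/- Setting. Let $M$ be a smooth $4$-manifold with a Lorentzian metric $g$ of signature $(1,3)$ and metric volume form $\tau$, and let $D$ be a smooth $g$-compatible connection, in general with torsion. All components below refer to an arbitrary smooth local frame $e_\mu$ with dual frame $\theta^\mu$, and every equation is understood in all such frames. Put $\varepsilon_{\alpha\beta\gamma\delta}=\tau(e_\alpha,e_\beta,e_\gamma,e_\delta)$, $$T^\rho_{\alpha\beta}=\theta^\rho\big(D_{e_\alpha}e_\beta-D_{e_\beta}e_\alpha-[e_\alpha,e_\beta]\big),\qquad R_\mu{}^\rho{}_{\alpha\beta}=\theta^\rho\big((D_{e_\alpha}D_{e_\beta}-D_{e_\beta}D_{e_\alpha}-D_{[e_\alpha,e_\beta]})e_\mu\big),$$ $T_{\rho\alpha\beta}=g_{\rho\sigma}T^\sigma_{\alpha\beta}$, $R_{\mu\rho\alpha\beta}=g_{\rho\sigma}R_\mu{}^\sigma{}_{\alpha\beta}$, $R_{\mu\nu}=R_\mu{}^\rho{}_{\rho\nu}$, $R=g^{\mu\nu}R_{\mu\nu}$, $G_{\mu\nu}=R_{\mu\nu}-\frac12 g_{\mu\nu}R$. A star denotes the Hodge dual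 in the last two (form) indices: $R^\star_{\mu\rho\lambda\sigma}=\frac12 R_{\mu\rho}{}^{\kappa\iota}\varepsilon_{\kappa\iota\lambda\sigma}$ and $T^{\star\rho}_{\lambda\sigma}=\frac12 T^{\rho\,\kappa\iota}\varepsilon_{\kappa\iota\lambda\sigma}$; $R^\star_{\mu\nu}$, $R^\star$ and $G^\star_{\mu\nu}$ are the Ricci, scalar and Einstein contractions of $R^\star_\mu{}^\rho{}_{\alpha\beta}$. $\sum_{(abc)}$ is the cyclic sum over $a,b,c$. Let $\mathbf T$ (components $T_{\mu\nu}$), $\Theta$ and $\mathbf T'$ (components $T'_{\mu\nu}$) be $(0,2)$ tensor fields, not necessarily symmetric, with $T_\mu^\kappa=T_{\mu\nu}g^{\nu\kappa}$ and traces $T=T_\kappa^\kappa$, and similarly for $\Theta$ and $\mathbf T'$. Suppose that $(M,g,D)$ satisfies the postulated equations $$R^\star_{\mu\rho\lambda\sigma}+R^\star_{\mu\lambda\sigma\rho}+R^\star_{\mu\sigma\rho\lambda}=\varepsilon_{\rho\lambda\sigma\kappa}T_\mu^\kappa,\qquad G_{\mu\nu}=T_{\mu\nu},$$ $$\sum_{(\mu\alpha\beta)}R_{\mu\rho\alpha\beta}=\varepsilon_{\mu\alpha\beta\kappa}\Theta_\rho^\kappa,\qquad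 \sum_{(\mu\nu\rho)}D_\mu R_{\beta\alpha\nu\rho}=0 .$$ (1) Then $R=0$, $T=0$, and $$\varepsilon_{\mu\alpha\beta\kappa}\Theta_\rho^\kappa=\sum_{(\mu\alpha\beta)}\big(D_\mu T_{\rho\alpha\beta}-T^\kappa_{\mu\beta}T_{\rho\kappa\alpha}\big),\qquad \sum_{(\mu\nu\rho)}T^\kappa_{\nu\mu}R_{\beta\alpha\kappa\rho}=0 .$$ (2) Suppose in addition that $D'$ is a smooth $g$-compatible connection whose torsion and curvature $2$-forms are the Hodge duals of those of $D$, i.e. $T'^{\rho}_{\alpha\beta}=T^{\star\rho}_{\alpha\beta}$ and $R'_\mu{}^\rho{}_{\alpha\beta}=R^\star_\mu{}^\rho{}_{\alpha\beta}$, and that the Einstein equation $G'_{\mu\nu}=T'_{\mu\nu}$ holds for $D'$. Then $$\varepsilon_{\rho\lambda\sigma\kappa}T_\mu'^{\kappa}+\tfrac12 T_\kappa'^{\kappa}\,\varepsilon_{\mu\rho\lambda\sigma}=\varepsilon_{\rho\lambda\sigma\kappa}\Theta_\mu^\kappa .$$ (3) Suppose moreover that, for a sign $s\in\{1,-1\}$,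 the dual equations $$G^\star_{\mu\nu}=\Theta_{\mu\nu},\qquad \sum_{(\mu\alpha\beta)}R^\star_{\mu\rho\alpha\beta}=s\,\varepsilon_{\mu\alpha\beta\kappa}T_\rho^\kappa,\qquad \sum_{(\mu\nu\rho)}D'_\mu R^\star_{\beta\alpha\nu\rho}=0$$ hold. Then $R^\star=0$, $T_\mu'^{\kappa}=\Theta_\mu^\kappa$, $T=0$, $\Theta=\Theta_\kappa^\kappa=0$, and $$\varepsilon_{\mu\alpha\beta\kappa}\Theta_\rho^\kappa=\sum_{(\mu\alpha\beta)}\big(D_\mu T_{\rho\alpha\beta}-T^\kappa_{\mu\beta}T_{\rho\kappa\alpha}\big),\qquad s\,\varepsilon_{\mu\alpha\beta\kappa}T_\rho^\kappa=\sum_{(\mu\alpha\beta)}\big(D'_\mu T^\star_{\rho\alpha\beta}-T^{\star\kappa}_{\mu\beta}T^\star_{\rho\kappa\alpha}\big),$$ $$\sum_{(\mu\nu\rho)}T^\kappa_{\nu\mu}R_{\beta\alpha\kappa\rho}=0,\qquad \sum_{(\mu\nu\rho)}T^{\star\kappa}_{\nu\mu}R^\star_{\beta\alpha\kappa\rho}=0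 .$$ -/

import Mathlib

open Bundle Manifold
open scoped ContDiff Manifold

noncomputable section

/-- The model space of four-dimensional manifolds. -/
abbrev E4 : Type := EuclideanSpace ℝ (Fin 4)

section Structures

variable (M : Type*) [TopologicalSpace M] [ChartedSpace E4 M] [IsManifold (𝓡 4) ∞ M]

/-- A smooth metric tensor of signature `(1,3)` on a `4`-manifold. -/
structure LorentzMetric where
  /-- The bilinear form on each tangent space. -/
  val (x : M) : TangentSpace (𝓡 4) x →L[ℝ] TangentSpace (𝓡 4) x →L[ℝ] ℝ
  symm (x : M) (v w : TangentSpace (𝓡 4) x) : val x v w = val x w v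
  signature (x : M) : ∃ b : Module.Basis (Fin 4) ℝ (TangentSpace (𝓡 4) x),
    ∀ i j, val x (b i) (b j) = Matrix.diagonal ![(1 : ℝ), -1, -1, -1] i j
  contMDiff : ContMDiff (𝓡 4) ((𝓡 4).prod 𝓘(ℝ, E4 →L[ℝ] E4 →L[ℝ] ℝ)) ∞
    (fun x ↦ TotalSpace.mk' (E4 →L[ℝ] E4 →L[ℝ] ℝ) x (val x))

/-- A smooth moving frame `e_0, …, e_3` of the tangent bundle over an open set `dom`. The values
of the vector fields outside `dom` are irrelevant. -/
structure MovingFrame where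
  /-- The domain of the frame. -/
  dom : Set M
  isOpen_dom : IsOpen dom
  /-- The vector fields of the frame. -/
  vec : Fin 4 → (x : M) → TangentSpace (𝓡 4) x
  isFrame : IsLocalFrameOn (𝓡 4) E4 ∞ vec dom

/-- A (not necessarily symmetric) tensor field of type `(0,2)`, for instance the energy-momentum
tensor of a matter distribution. -/
abbrev TwoTensor : Type _ :=
  (x : M) → TangentSpace (𝓡 4) x →ₗ[ℝ] TangentSpace (𝓡 4) x →ₗ[ℝ] ℝ

variable {M}

/-- A metric volume form of `g`, i.e. a smooth `4`-form `τ` with `τ · τ = -1`; equivalently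
`τ(v₀, v₁, v₂, v₃)² = |det g(vᵢ, vⱼ)|`. It orients `M`. -/
structure VolumeForm (g : LorentzMetric M) where
  /-- The alternating form on each tangent space. -/
  val (x : M) : TangentSpace (𝓡 4) x [⋀^Fin 4]→ₗ[ℝ] ℝ
  sq_val (x : M) (v : Fin 4 → TangentSpace (𝓡 4) x) :
    val x v ^ 2 = |(Matrix.of fun i j ↦ g.val x (v i) (v j)).det|
  contMDiffOn (U : Set M) (hU : IsOpen U) (X : Fin 4 → (x : M) → TangentSpace (𝓡 4) x)
    (hX : ∀ i, ContMDiffOn (𝓡 4) (𝓡 4).tangent ∞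
      (fun x ↦ (⟨x, X i x⟩ : TangentBundle (𝓡 4) M)) U) :
    ContMDiffOn (𝓡 4) 𝓘(ℝ, ℝ) ∞ (fun x ↦ val x fun i ↦ X i x) U

/-- A smooth metric-compatible connection on the tangent bundle, in general with torsion, so that
`(M, g, D)` is a Riemann-Cartan structure. `D.conn w x v` is the covariant derivative at `x` of
the vector field `w` in the direction `v`. -/
structure MetricConnection (g : LorentzMetric M) where
  /-- The covariant derivative. -/
  conn : CovariantDerivative (𝓡 4) E4 (TangentSpace (𝓡 4) : M → Type _)
  smooth : CovariantDerivative.ContMDiffCovariantDerivative conn ∞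
  metric {x : M} {v w : (x : M) → TangentSpace (𝓡 4) x}
    (hv : MDifferentiableAt (𝓡 4) (𝓡 4).tangent (fun y ↦ (⟨y, v y⟩ : TangentBundle (𝓡 4) M)) x)
    (hw : MDifferentiableAt (𝓡 4) (𝓡 4).tangent (fun y ↦ (⟨y, w y⟩ : TangentBundle (𝓡 4) M)) x)
    (u : TangentSpace (𝓡 4) x) :
    mvfderiv (𝓡 4) (fun y ↦ g.val y (v y) (w y)) x u
      = g.val x (conn v x u) (w x) + g.val x (v x) (conn w x u)

end Structures

variable {M : Type*} [TopologicalSpace M] [ChartedSpace E4 M] [IsManifold (𝓡 4) ∞ M]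

/-- The cyclic sum over three indices. -/
def cyc3 (f : Fin 4 → Fin 4 → Fin 4 → ℝ) (a b c : Fin 4) : ℝ := f a b c + f b c a + f c a b

/-! ### Components in a moving frame -/

/-- `θ^ρ(v)`, for the dual frame `θ` of the moving frame `e`. -/
def MovingFrame.theta (e : MovingFrame M) (ρ : Fin 4) (x : M) (v : TangentSpace (𝓡 4) x) : ℝ :=
  e.isFrame.coeff ρ x v

/-- `g_{μν}`. -/
def LorentzMetric.down (g : LorentzMetric M) (e : MovingFrame M) (x : M) :
    Matrix (Fin 4) (Fin 4) ℝ :=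
  Matrix.of fun μ ν ↦ g.val x (e.vec μ x) (e.vec ν x)

/-- `g^{μν}`. -/
def LorentzMetric.up (g : LorentzMetric M) (e : MovingFrame M) (x : M) :
    Matrix (Fin 4) (Fin 4) ℝ :=
  (g.down e x)⁻¹

/-- The Levi-Civita tensor `ε_{αβγδ} = τ(e_α, e_β, e_γ, e_δ)`, which is `√|det g|` times the
permutation symbol in a positively oriented frame. -/
def VolumeForm.eps {g : LorentzMetric M} (τ : VolumeForm g) (e : MovingFrame M) (x : M)
    (α β γ δ : Fin 4) : ℝ :=
  τ.val x ![e.vec α x, e.vec β x, e.vec γ x, e.vec δ x]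

/-- `t_{μν}`. -/
def TwoTensor.down (t : TwoTensor M) (e : MovingFrame M) (x : M) (μ ν : Fin 4) : ℝ :=
  t x (e.vec μ x) (e.vec ν x)

/-- `t_μ^κ = t_{μν} g^{νκ}`. -/
def TwoTensor.mixed (g : LorentzMetric M) (t : TwoTensor M) (e : MovingFrame M) (x : M)
    (μ κ : Fin 4) : ℝ :=
  ∑ ν, TwoTensor.down t e x μ ν * g.up e x ν κ

/-- The trace `t_κ^κ`. -/
def TwoTensor.trace (g : LorentzMetric M) (t : TwoTensor M) (e : MovingFrame M) (x : M) : ℝ :=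
  ∑ κ, TwoTensor.mixed g t e x κ κ

/-- Components `A^ρ_{αβ}` of a vector-valued `2`-form, as functions on the manifold; the indices
are listed in the order `ρ α β`. -/
abbrev TorsionComponents (M : Type*) : Type _ := M → Fin 4 → Fin 4 → Fin 4 → ℝ

/-- Components `A_μ^ρ_{αβ}` (or `A_{μραβ}`) as functions on the manifold; the indices are listed
in the order `μ ρ α β`. -/
abbrev CurvatureComponents (M : Type*) : Type _ := M → Fin 4 → Fin 4 → Fin 4 → Fin 4 → ℝ

/-- The curvature operation `ρ(u,v)w = D_u D_v w - D_v D_u w - D_{[u,v]} w`. -/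
def curvatureOp (D : CovariantDerivative (𝓡 4) E4 (TangentSpace (𝓡 4) : M → Type _))
    (u v w : (x : M) → TangentSpace (𝓡 4) x) (x : M) : TangentSpace (𝓡 4) x :=
  D (fun y ↦ D w y (v y)) x (u x) - D (fun y ↦ D w y (u y)) x (v x)
    - D w x (VectorField.mlieBracket (𝓡 4) u v x)

namespace MetricConnection

variable {g : LorentzMetric M}

/-- The connection coefficients `L^ρ_{αβ} = θ^ρ(D_{e_α} e_β)`. -/
def coef (D : MetricConnection g) (e : MovingFrame M) (x : M) (ρ α β : Fin 4) : ℝ :=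
  e.theta ρ x (D.conn (e.vec β) x (e.vec α x))

/-- The torsion components `T^ρ_{αβ} = θ^ρ(D_{e_α} e_β - D_{e_β} e_α - [e_α, e_β])`. -/
def tor (D : MetricConnection g) (e : MovingFrame M) : TorsionComponents M := fun x ρ α β ↦
  e.theta ρ x (D.conn.torsion x (e.vec α x) (e.vec β x))

/-- The curvature components `R_μ^ρ_{αβ} = θ^ρ(ρ(e_α, e_β) e_μ)`. -/
def curv (D : MetricConnection g) (e : MovingFrame M) : CurvatureComponents M := fun x μ ρ α β ↦
  e.theta ρ x (curvatureOp D.conn (e.vec α) (e.vec β) (e.vec μ) x)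

/-- The covariant derivative `D_μ A_{ραβ}` of a tensor with components `A_{ραβ}`. -/
def cov3 (D : MetricConnection g) (e : MovingFrame M) (A : TorsionComponents M) (x : M)
    (μ ρ α β : Fin 4) : ℝ :=
  mvfderiv (𝓡 4) (fun y ↦ A y ρ α β) x (e.vec μ x)
    - ∑ σ, (D.coef e x σ μ ρ * A x σ α β + D.coef e x σ μ α * A x ρ σ β
        + D.coef e x σ μ β * A x ρ α σ)

/-- The covariant derivative `D_μ A_{βανρ}` of a tensor with components `A_{βανρ}`. -/
def cov4 (D : MetricConnection g) (e : MovingFrame M) (A : CurvatureComponents M) (x : M)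
    (μ β α ν ρ : Fin 4) : ℝ :=
  mvfderiv (𝓡 4) (fun y ↦ A y β α ν ρ) x (e.vec μ x)
    - ∑ σ, (D.coef e x σ μ β * A x σ α ν ρ + D.coef e x σ μ α * A x β σ ν ρ
        + D.coef e x σ μ ν * A x β α σ ρ + D.coef e x σ μ ρ * A x β α ν σ)

end MetricConnection

/-! ### Algebraic operations on components -/

/-- `A_{ραβ} = g_{ρσ} A^σ_{αβ}`. -/
def lower3 (g : LorentzMetric M) (e : MovingFrame M) (A : TorsionComponents M) :
    TorsionComponents M := fun x ρ α β ↦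
  ∑ σ, g.down e x ρ σ * A x σ α β

/-- `A_{μραβ} = g_{ρσ} A_μ^σ_{αβ}`. -/
def lower4 (g : LorentzMetric M) (e : MovingFrame M) (A : CurvatureComponents M) :
    CurvatureComponents M := fun x μ ρ α β ↦
  ∑ σ, g.down e x ρ σ * A x μ σ α β

/-- The Hodge dual of a `2`-form, `(⋆F)_{αβ} = ½ F^{κι} ε_{κιαβ}`. -/
def hodge2 {g : LorentzMetric M} (τ : VolumeForm g) (e : MovingFrame M) (x : M)
    (F : Fin 4 → Fin 4 → ℝ) (α β : Fin 4) : ℝ :=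
  1 / 2 * ∑ κ, ∑ ι, (∑ γ, ∑ δ, g.up e x κ γ * g.up e x ι δ * F γ δ) * τ.eps e x κ ι α β

/-- The components `T^{⋆ρ}_{αβ}` of the duals of the `2`-forms with components `A^ρ_{αβ}`. -/
def star3 {g : LorentzMetric M} (τ : VolumeForm g) (e : MovingFrame M) (A : TorsionComponents M) :
    TorsionComponents M := fun x ρ ↦ hodge2 τ e x (A x ρ)

/-- The components `R^⋆_μ^ρ_{αβ}` of the duals of the `2`-forms with components `A_μ^ρ_{αβ}`. -/
def star4 {g : LorentzMetric M} (τ : VolumeForm g) (e : MovingFrame M)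
    (A : CurvatureComponents M) : CurvatureComponents M := fun x μ ρ ↦ hodge2 τ e x (A x μ ρ)

/-- `R_{μν} = R_μ^ρ_{ρν}`. -/
def ricci (R : CurvatureComponents M) (x : M) (μ ν : Fin 4) : ℝ := ∑ ρ, R x μ ρ ρ ν

/-- `R = g^{μν} R_{μν}`. -/
def scalar (g : LorentzMetric M) (e : MovingFrame M) (R : CurvatureComponents M) (x : M) : ℝ :=
  ∑ μ, ∑ ν, g.up e x μ ν * ricci R x μ ν

/-- `G_{μν} = R_{μν} - ½ g_{μν} R`. -/
def einstein (g : LorentzMetric M) (e : MovingFrame M) (R : CurvatureComponents M) (x : M)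
    (μ ν : Fin 4) : ℝ :=
  ricci R x μ ν - 1 / 2 * g.down e x μ ν * scalar g e R x

/-- `Σ_{(μαβ)} (D_μ A_{ραβ} - A^κ_{μβ} A_{ρκα})`, the torsion side of the first Bianchi identity,
for a tensor with components `A^ρ_{αβ}`. -/
def torsionSide {g : LorentzMetric M} (D : MetricConnection g) (e : MovingFrame M)
    (A : TorsionComponents M) (x : M) (μ ρ α β : Fin 4) : ℝ :=
  cyc3 (fun μ α β ↦ D.cov3 e (lower3 g e A) x μ ρ α β
    - ∑ κ, A x κ μ β * lower3 g e A x ρ κ α) μ α β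

/-- `Σ_{(μνρ)} A^κ_{νμ} R_{βακρ}`, the torsion side of the second Bianchi identity. -/
def torsionCurvatureSide (g : LorentzMetric M) (e : MovingFrame M) (A : TorsionComponents M)
    (R : CurvatureComponents M) (x : M) (β α μ ν ρ : Fin 4) : ℝ :=
  cyc3 (fun μ ν ρ ↦ ∑ κ, A x κ ν μ * lower4 g e R x β α κ ρ) μ ν ρ

/-- `ε_{αβγκ} t_ρ^κ`. -/
def epsMixed {g : LorentzMetric M} (τ : VolumeForm g) (t : TwoTensor M) (e : MovingFrame M)
    (x : M) (α β γ ρ : Fin 4) : ℝ :=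
  ∑ κ, τ.eps e x α β γ κ * TwoTensor.mixed g t e x ρ κ

/-! ### The systems of equations -/

/-- The Einstein equation `G_{μν} = t_{μν}` of `(M, g, D)`, in every moving frame. -/
def EinsteinEquation {g : LorentzMetric M} (D : MetricConnection g) (t : TwoTensor M) : Prop :=
  ∀ (e : MovingFrame M), ∀ x ∈ e.dom, ∀ μ ν,
    einstein g e (D.curv e) x μ ν = TwoTensor.down t e x μ ν

/-- The equations postulated for the curvature of `(M, g, D)`, with sources `T` and `Θ`. -/
structure PostulatedEquations {g : LorentzMetric M} (τ : VolumeForm g) (D : MetricConnection g)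
    (T Θ : TwoTensor M) : Prop where
  /-- `R^⋆_{μρλσ} + R^⋆_{μλσρ} + R^⋆_{μσρλ} = ε_{ρλσκ} T_μ^κ`. -/
  dualCyclic (e : MovingFrame M) (x : M) (hx : x ∈ e.dom) (μ ρ l σ : Fin 4) :
    cyc3 (fun ρ l σ ↦ lower4 g e (star4 τ e (D.curv e)) x μ ρ l σ) ρ l σ
      = epsMixed τ T e x ρ l σ μ
  /-- `G_{μν} = T_{μν}`. -/
  einsteinEq : EinsteinEquation D T
  /-- `Σ_{(μαβ)} R_{μραβ} = ε_{μαβκ} Θ_ρ^κ`. -/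
  cyclic (e : MovingFrame M) (x : M) (hx : x ∈ e.dom) (μ ρ α β : Fin 4) :
    cyc3 (fun μ α β ↦ lower4 g e (D.curv e) x μ ρ α β) μ α β = epsMixed τ Θ e x μ α β ρ
  /-- `Σ_{(μνρ)} D_μ R_{βανρ} = 0`. -/
  differential (e : MovingFrame M) (x : M) (hx : x ∈ e.dom) (β α μ ν ρ : Fin 4) :
    cyc3 (fun μ ν ρ ↦ D.cov4 e (lower4 g e (D.curv e)) x μ β α ν ρ) μ ν ρ = 0

/-- The torsion and curvature `2`-forms of `D'` are the Hodge duals of those of `D`. -/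
structure IsDualConnection {g : LorentzMetric M} (τ : VolumeForm g)
    (D D' : MetricConnection g) : Prop where
  torsion (e : MovingFrame M) (x : M) (hx : x ∈ e.dom) (ρ α β : Fin 4) :
    D'.tor e x ρ α β = star3 τ e (D.tor e) x ρ α β
  curvature (e : MovingFrame M) (x : M) (hx : x ∈ e.dom) (μ ρ α β : Fin 4) :
    D'.curv e x μ ρ α β = star4 τ e (D.curv e) x μ ρ α β

/-- The dual equations. The sign `s` is the sign of the source in the algebraic identity for the
dual curvature. -/
structure DualEquations {g : LorentzMetric M} (τ : VolumeForm g) (D D' : MetricConnection g)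
    (s : ℝ) (T Θ : TwoTensor M) : Prop where
  /-- `G^⋆_{μν} = Θ_{μν}`. -/
  einsteinEq (e : MovingFrame M) (x : M) (hx : x ∈ e.dom) (μ ν : Fin 4) :
    einstein g e (star4 τ e (D.curv e)) x μ ν = TwoTensor.down Θ e x μ ν
  /-- `Σ_{(μαβ)} R^⋆_{μραβ} = s ε_{μαβκ} T_ρ^κ`. -/
  cyclic (e : MovingFrame M) (x : M) (hx : x ∈ e.dom) (μ ρ α β : Fin 4) :
    cyc3 (fun μ α β ↦ lower4 g e (star4 τ e (D.curv e)) x μ ρ α β) μ α β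
      = s * epsMixed τ T e x μ α β ρ
  /-- `Σ_{(μνρ)} D'_μ R^⋆_{βανρ} = 0`. -/
  differential (e : MovingFrame M) (x : M) (hx : x ∈ e.dom) (β α μ ν ρ : Fin 4) :
    cyc3 (fun μ ν ρ ↦ D'.cov4 e (lower4 g e (star4 τ e (D.curv e))) x μ β α ν ρ) μ ν ρ = 0

end

/-!
The theorem reduces to three facts about a metric connection `D` with torsion.

*Algebra.* At a point, `ε = ε₀₁₂₃ · levi` with `levi` the permutation symbol, and
`ε₀₁₂₃² = -det g` since the signature is `(1,3)`. Antisymmetrizing `g_{ρτ} ε_{κιλσ}` over the five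
indices `ρκιλσ` gives zero in dimension four; contracted with a curvature-like tensor `A`, this says
that the cyclic sum of `A^⋆_{μρλσ}` over `ρλσ` is `ε_{ρλσκ} A_μ^κ`, with `A_{μν}` the Ricci
contraction of `A` (`cyc3_lower4_star4`). As `ε₀₁₂₃ ≠ 0`, the Ricci contraction is determined by the
cyclic sum (`ricci_eq_of_cyc3_eq`). Moreover `⋆⋆ = -1` on `2`-forms (`star4_star4`).

*Bianchi identities.* The Jacobi identity for vector fields gives the first one,
`R(Y,Z)X + cyclic = D_X (T(Y,Z)) - T(D_X Y,Z) - T(Y,D_X Z) - T(T(X,Z),Y) + cyclic`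
(`first_bianchi`), and the second one, in which the cyclic sum of the covariant derivative of the
curvature is `-R(T(X,Y),Z)` plus cyclic permutations (`second_bianchi`). Both are then read in
components of a moving frame.

*Metricity.* `R_{μραβ} = -R_{ρμαβ}` (`lower4_curv_antisymm`). It comes from `XYf - YXf = [X,Y]f`
for `f = g(Z,W)`, itself extracted from the Jacobi identity for `X, Y` and `f W`.

The first postulated equation therefore says `R_{μν} = T_{μν}`; comparison with `G_{μν} = T_{μν}`
gives `R = 0`. By `⋆⋆ = -1` and the antisymmetry in `μρ`, the third one says that the Ricci
contraction of `R^⋆` is `Θ` (`ricci_star4_eq`). The Einstein equation of the dual connection then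
reads `T' = Θ - ½ R^⋆ g`, whose trace is `-R^⋆`: this is part (2). In part (3), `G^⋆ = Θ` forces
`R^⋆ = 0`, and the remaining formulas are the Bianchi identities of `D` and `D'`.
-/

open VectorField Filter Topology

/-! ### The permutation symbol -/

/-- The permutation symbol on four indices, as a Vandermonde product: for a permutation `a b c d`
of `0 1 2 3` the product of all differences is `± 12`. -/
def levi (a b c d : Fin 4) : ℤ :=
  (((b : ℕ) : ℤ) - (a : ℕ)) * (((c : ℕ) : ℤ) - (a : ℕ)) * (((d : ℕ) : ℤ) - (a : ℕ)) *
    (((c : ℕ) : ℤ) - (b : ℕ)) * (((d : ℕ) : ℤ) - (b : ℕ)) * (((d : ℕ) : ℤ) - (c : ℕ)) / 12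

theorem levi_swap_left (a b c d : Fin 4) : levi b a c d = -levi a b c d := by
  revert a b c d
  decide +kernel

theorem levi_swap_right (a b c d : Fin 4) : levi a b d c = -levi a b c d := by
  revert a b c d
  decide +kernel

theorem levi_cycle (a b c d : Fin 4) : levi a c d b = levi a b c d := by
  revert a b c d
  decide +kernel

theorem levi_rotate (a b c d : Fin 4) : levi d a b c = -levi a b c d := by
  revert a b c d
  decide +kernel

/-- Antisymmetrization of `δ_{rt} ε_{kils}` over the five indices `r k i l s` vanishes. -/
theorem levi_five_index (t r k i l s : Fin 4) :
    (if r = t then levi k i l s else 0) - (if k = t then levi r i l s else 0)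
      - (if i = t then levi k r l s else 0) - (if l = t then levi k i r s else 0)
      - (if s = t then levi k i l r else 0) = 0 := by
  revert t r k i l s
  decide +kernel

theorem levi_contract (k i c d : Fin 4) :
    ∑ a, ∑ b, levi k i a b * levi a b c d
      = 2 * ((if k = c ∧ i = d then 1 else 0) - (if k = d ∧ i = c then 1 else 0)) := by
  revert k i c d
  decide +kernel

theorem sum_levi_eq_det (u v w z : Fin 4 → ℝ) :
    ∑ a, ∑ b, ∑ c, ∑ d, u a * v b * w c * z d * (levi a b c d : ℝ)
      = (Matrix.of ![u, v, w, z]).det := by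
  rw [Matrix.det_succ_row_zero]
  simp [Fin.sum_univ_four, levi, Matrix.det_fin_three, Fin.succAbove]
  ring

/-- The permutation symbol as a determinant of standard basis vectors, the form in which it meets
`Module.Basis.det`. -/
theorem levi_eq_det (a b c d : Fin 4) :
    (levi a b c d : ℝ)
      = (Matrix.of fun i : Fin 4 ↦ (Pi.single (![a, b, c, d] i) 1 : Fin 4 → ℝ)).det := by
  have h := sum_levi_eq_det (Pi.single a 1) (Pi.single b 1) (Pi.single c 1) (Pi.single d 1)
  simp only [Pi.single_apply, ite_mul, mul_ite, one_mul, mul_one, zero_mul, mul_zero,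
    Finset.sum_ite_eq', Finset.mem_univ, if_true] at h
  rw [h]
  congr 1
  ext i j
  fin_cases i <;> rfl

/-- Raising all four indices of the permutation symbol with `U` multiplies it by `det U`. -/
theorem sum_mul_levi (U : Matrix (Fin 4) (Fin 4) ℝ) (a b c d : Fin 4) :
    ∑ p, ∑ q, ∑ r, ∑ s, U p a * U q b * U r c * U s d * (levi p q r s : ℝ)
      = U.det * levi a b c d := by
  rw [sum_levi_eq_det (fun p ↦ U p a) (fun q ↦ U q b) (fun r ↦ U r c) (fun s ↦ U s d),
    levi_eq_det, ← Matrix.det_transpose U, mul_comm, ← Matrix.det_mul]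
  congr 1
  ext i j
  have h : ∀ x, U j x = ∑ k, (Pi.single x 1 : Fin 4 → ℝ) k * U j k := fun x ↦ by
    simp [Pi.single_apply]
  rw [Matrix.mul_apply]
  fin_cases i
  exacts [h a, h b, h c, h d]

theorem vec_five_index (v : Fin 4 → ℝ) (r k i l s : Fin 4) :
    v r * levi k i l s - v k * levi r i l s - v i * levi k r l s - v l * levi k i r s
      - v s * levi k i l r = 0 := by
  have h : ∀ t, v t * ((if r = t then (levi k i l s : ℝ) else 0)
      - (if k = t then (levi r i l s : ℝ) else 0)
      - (if i = t then (levi k r l s : ℝ) else 0) - (if l = t then (levi k i r s : ℝ) else 0)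
      - (if s = t then (levi k i l r : ℝ) else 0)) = 0 := fun t ↦ by
    have := levi_five_index t r k i l s
    have h2 := congrArg (Int.cast : ℤ → ℝ) this
    push_cast at h2
    rw [h2, mul_zero]
  have h' := Finset.sum_eq_zero fun t (_ : t ∈ Finset.univ) ↦ h t
  simpa [mul_sub, Finset.sum_sub_distrib] using h'

/-! ### Hodge duality at a point -/

/-- The five-index identity contracted with a family `B` of bivectors: the cyclic sum of
`g_{rt} B^{tki} ε_{kils}` only involves the contraction `g_{kt} B^{tki}`. -/
theorem sum_cyc_levi (G : Matrix (Fin 4) (Fin 4) ℝ) (B : Fin 4 → Fin 4 → Fin 4 → ℝ)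
    (hB : ∀ t k i, B t i k = -B t k i) (r l s : Fin 4) :
    ∑ t, ∑ k, ∑ i, B t k i * (G r t * levi k i l s + G l t * levi k i s r + G s t * levi k i r l)
      = 2 * ∑ i, (∑ t, ∑ k, G k t * B t k i) * levi r l s i := by
  have h1 : ∀ t k i, B t k i *
      (G r t * levi k i l s + G l t * levi k i s r + G s t * levi k i r l)
      = B t k i * G k t * levi r l s i + B t i k * G i t * levi r l s k := fun t k i ↦ by
    have h := vec_five_index (fun a ↦ G a t) r k i l s
    have e1 : (levi k i s r : ℝ) = -levi k i r s := by exact_mod_cast levi_swap_right k i r s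
    have e2 : (levi k i r l : ℝ) = -levi k i l r := by exact_mod_cast levi_swap_right k i l r
    have e3 : (levi r l s i : ℝ) = levi r i l s := by exact_mod_cast levi_cycle r i l s
    have e4 : (levi r l s k : ℝ) = levi r k l s := by exact_mod_cast levi_cycle r k l s
    have e5 : (levi k r l s : ℝ) = -levi r k l s := by exact_mod_cast levi_swap_left r k l s
    rw [e1, e2, e3, e4, hB t k i]
    rw [e5] at h
    linear_combination B t k i * h
  simp_rw [h1, Finset.sum_add_distrib]
  have h2 : ∀ t, ∑ k, ∑ i, B t i k * G i t * (levi r l s k : ℝ)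
      = ∑ k, ∑ i, B t k i * G k t * (levi r l s i : ℝ) := fun t ↦ Finset.sum_comm
  simp_rw [h2]
  rw [← two_mul]
  congr 1
  simp_rw [Finset.sum_mul]
  rw [Finset.sum_comm' (t' := Finset.univ) (s' := fun _ ↦ Finset.univ) (by simp)]
  conv_rhs => rw [Finset.sum_comm]
  conv_lhs => rw [Finset.sum_comm]
  refine Finset.sum_congr rfl fun t _ ↦ ?_
  rw [Finset.sum_comm]
  refine Finset.sum_congr rfl fun k _ ↦ Finset.sum_congr rfl fun i _ ↦ by ring

/-- The Hodge dual of a `2`-form `F` on a four-dimensional space with inverse metric `U` and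
Levi-Civita tensor `c · levi`. -/
noncomputable def dualForm (U : Matrix (Fin 4) (Fin 4) ℝ) (c : ℝ) (F : Fin 4 → Fin 4 → ℝ)
    (α β : Fin 4) : ℝ :=
  1 / 2 * ∑ κ, ∑ ι, (∑ γ, ∑ δ, U κ γ * U ι δ * F γ δ) * (c * levi κ ι α β)

theorem dualForm_swap (U : Matrix (Fin 4) (Fin 4) ℝ) (c : ℝ) (F : Fin 4 → Fin 4 → ℝ) (α β : Fin 4) :
    dualForm U c F β α = -dualForm U c F α β := by
  have : ∀ k i, (levi k i β α : ℝ) = -levi k i α β := fun k i ↦ by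
    exact_mod_cast levi_swap_right k i α β
  simp [dualForm, this]

/-- For a family `A^t` of `2`-forms, the cyclic sum of the components of the dual forms, with `t`
lowered, depends only on the contraction `A^t_{tn}`. -/
theorem cyc3_dualForm (G U : Matrix (Fin 4) (Fin 4) ℝ) (hGU : G.transpose * U = 1)
    (hU : U.IsSymm) (c : ℝ)
    (A : Fin 4 → Fin 4 → Fin 4 → ℝ) (hA : ∀ t a b, A t b a = -A t a b) (r l s : Fin 4) :
    cyc3 (fun r l s ↦ ∑ t, G r t * dualForm U c (A t) l s) r l s
      = ∑ k, c * levi r l s k * ∑ n, (∑ t, A t t n) * U n k := by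
  -- `A^t` with its form indices raised
  set B : Fin 4 → Fin 4 → Fin 4 → ℝ := fun t k i ↦ ∑ γ, ∑ δ, U k γ * U i δ * A t γ δ with hBdef
  have hB : ∀ t k i, B t i k = -B t k i := fun t k i ↦ by
    simp only [hBdef, ← Finset.sum_neg_distrib]
    rw [Finset.sum_comm]
    refine Finset.sum_congr rfl fun a _ ↦ Finset.sum_congr rfl fun b _ ↦ ?_
    rw [hA t a b]; ring
  have hd : ∀ t l s, dualForm U c (A t) l s
      = 1 / 2 * ∑ k, ∑ i, B t k i * (c * levi k i l s) := fun t l s ↦ rfl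
  have h := sum_cyc_levi G B hB r l s
  have hc : cyc3 (fun r l s ↦ ∑ t, G r t * dualForm U c (A t) l s) r l s
      = c / 2 * ∑ t, ∑ k, ∑ i, B t k i *
        (G r t * levi k i l s + G l t * levi k i s r + G s t * levi k i r l) := by
    simp only [cyc3, hd, Finset.mul_sum, ← Finset.sum_add_distrib]
    refine Finset.sum_congr rfl fun t _ ↦ Finset.sum_congr rfl fun k _ ↦
      Finset.sum_congr rfl fun i _ ↦ by ring
  have hric : ∀ i, ∑ t, ∑ k, G k t * B t k i = ∑ n, (∑ t, A t t n) * U n i := fun i ↦ by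
    have hδ : ∀ t γ, ∑ k, G k t * U k γ = if t = γ then 1 else 0 := fun t γ ↦ by
      have := congrFun (congrFun hGU t) γ
      simpa [Matrix.mul_apply, Matrix.one_apply] using this
    have h1 : ∀ t, ∑ k, G k t * B t k i = ∑ δ, U i δ * A t t δ := fun t ↦ by
      calc ∑ k, G k t * B t k i
          = ∑ k, ∑ γ, ∑ δ, G k t * U k γ * (U i δ * A t γ δ) := by
            simp only [hBdef, Finset.mul_sum]
            refine Finset.sum_congr rfl fun k _ ↦ Finset.sum_congr rfl fun i _ ↦
              Finset.sum_congr rfl fun t _ ↦ by ring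
        _ = ∑ γ, (∑ k, G k t * U k γ) * ∑ δ, U i δ * A t γ δ := by
            rw [Finset.sum_comm]
            refine Finset.sum_congr rfl fun γ _ ↦ ?_
            rw [Finset.sum_mul]
            simp only [Finset.mul_sum]
        _ = _ := by simp [hδ]
    simp only [h1, Finset.sum_mul]
    rw [Finset.sum_comm]
    refine Finset.sum_congr rfl fun n _ ↦ Finset.sum_congr rfl fun t _ ↦ ?_
    rw [hU.apply n i]; ring
  rw [hc, h]
  simp only [hric]
  rw [← mul_assoc, Finset.mul_sum]
  refine Finset.sum_congr rfl fun k _ ↦ by ring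

theorem sum_pair_comm {ι : Type*} [Fintype ι] (f : ι → ι → ι → ι → ℝ) :
    ∑ a, ∑ b, ∑ c, ∑ d, f a b c d = ∑ c, ∑ d, ∑ a, ∑ b, f a b c d := by
  have h := Finset.sum_comm (s := (Finset.univ : Finset (ι × ι)))
    (t := (Finset.univ : Finset (ι × ι)))
    (f := fun p q ↦ f p.1 p.2 q.1 q.2)
  simpa only [Fintype.sum_prod_type] using h

/-- In Lorentzian signature the Hodge star squares to `-1` on `2`-forms. -/
theorem dualForm_dualForm (U : Matrix (Fin 4) (Fin 4) ℝ) (hU : U.IsSymm) (c : ℝ)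
    (hc : c ^ 2 * U.det = -1)
    (F : Fin 4 → Fin 4 → ℝ) (hF : ∀ a b, F b a = -F a b) (α β : Fin 4) :
    dualForm U c (dualForm U c F) α β = -F α β := by
  -- With all indices of the inner symbol raised, the factor `det U` comes out.
  have h1 : ∀ a b, ∑ a', ∑ b', U a a' * U b b' * dualForm U c F a' b'
      = c / 2 * U.det * ∑ p, ∑ q, F p q * levi p q a b := fun a b ↦ by
    calc ∑ a', ∑ b', U a a' * U b b' * dualForm U c F a' b'
        = ∑ a', ∑ b', ∑ k, ∑ i, ∑ p, ∑ q, c / 2 * F p q *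
            (U k p * U i q * U a' a * U b' b * levi k i a' b') := by
          simp only [dualForm, Finset.mul_sum, Finset.sum_mul]
          refine Finset.sum_congr rfl fun a' _ ↦ Finset.sum_congr rfl fun b' _ ↦
            Finset.sum_congr rfl fun k _ ↦ Finset.sum_congr rfl fun i _ ↦
            Finset.sum_congr rfl fun p _ ↦ Finset.sum_congr rfl fun q _ ↦ ?_
          rw [hU.apply a' a, hU.apply b' b]; ring
      _ = ∑ k, ∑ i, ∑ a', ∑ b', ∑ p, ∑ q, c / 2 * F p q *
            (U k p * U i q * U a' a * U b' b * levi k i a' b') := sum_pair_comm _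
      _ = ∑ k, ∑ i, ∑ p, ∑ q, ∑ a', ∑ b', c / 2 * F p q *
            (U k p * U i q * U a' a * U b' b * levi k i a' b') :=
          Finset.sum_congr rfl fun k _ ↦ Finset.sum_congr rfl fun i _ ↦ sum_pair_comm _
      _ = ∑ p, ∑ q, ∑ k, ∑ i, ∑ a', ∑ b', c / 2 * F p q *
            (U k p * U i q * U a' a * U b' b * levi k i a' b') := sum_pair_comm _
      _ = _ := by
          simp only [← Finset.mul_sum, sum_mul_levi]
          simp only [Finset.mul_sum]
          refine Finset.sum_congr rfl fun p _ ↦ Finset.sum_congr rfl fun q _ ↦ by ring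
  have h2 : ∀ p q, ∑ a, ∑ b, (levi p q a b : ℝ) * levi a b α β
      = 2 * ((if p = α ∧ q = β then 1 else 0) - (if p = β ∧ q = α then 1 else 0)) := fun p q ↦ by
    exact_mod_cast levi_contract p q α β
  calc dualForm U c (dualForm U c F) α β
      = 1 / 2 * ∑ a, ∑ b, (∑ a', ∑ b', U a a' * U b b' * dualForm U c F a' b')
          * (c * levi a b α β) := rfl
    _ = c ^ 2 * U.det / 4 * ∑ a, ∑ b, ∑ p, ∑ q, F p q * ((levi p q a b : ℝ) * levi a b α β) := by
        simp only [h1, Finset.mul_sum, Finset.sum_mul]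
        refine Finset.sum_congr rfl fun p _ ↦ Finset.sum_congr rfl fun q _ ↦
          Finset.sum_congr rfl fun p _ ↦ Finset.sum_congr rfl fun q _ ↦ by ring
    _ = -1 / 4 * ∑ p, ∑ q, F p q * (2 * ((if p = α ∧ q = β then 1 else 0)
          - (if p = β ∧ q = α then 1 else 0))) := by
        rw [hc, sum_pair_comm]
        simp only [← Finset.mul_sum, h2]
    _ = -F α β := by
        have : ∀ x y : Fin 4, ∑ p, ∑ q, F p q * (if p = x ∧ q = y then (1:ℝ) else 0) = F x y :=
          fun x y ↦ by
            rw [Finset.sum_eq_single x, Finset.sum_eq_single y] <;> simp +contextual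
        have e : ∀ p q, F p q * (2 * ((if p = α ∧ q = β then 1 else 0)
          - (if p = β ∧ q = α then 1 else 0))) = 2 * (F p q * (if p = α ∧ q = β then (1:ℝ) else 0))
            - 2 * (F p q * (if p = β ∧ q = α then (1:ℝ) else 0)) := fun p q ↦ by ring
        simp only [e, Finset.sum_sub_distrib, ← Finset.mul_sum, this]
        rw [hF α β]; ring

/-- Contraction with the last index of the Levi-Civita tensor is injective. -/
theorem eq_of_sum_levi_eq (c : ℝ) (hc : c ≠ 0) (X Y : Fin 4 → ℝ)
    (h : ∀ r l s, ∑ k, c * levi r l s k * X k = ∑ k, c * levi r l s k * Y k) : X = Y := by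
  ext k
  fin_cases k
  · simpa [Fin.sum_univ_four, levi, hc] using h 1 2 3
  · simpa [Fin.sum_univ_four, levi, hc] using h 0 2 3
  · simpa [Fin.sum_univ_four, levi, hc] using h 0 1 3
  · simpa [Fin.sum_univ_four, levi, hc] using h 0 1 2

/-! ### Smoothness of vector fields -/

theorem mvfderiv_congr {M : Type*} [TopologicalSpace M] [ChartedSpace E4 M] {f f' : M → ℝ} {x : M}
    (h : f =ᶠ[𝓝 x] f') : mvfderiv (𝓡 4) f x = mvfderiv (𝓡 4) f' x := by
  simp only [mvfderiv]
  rw [h.mfderiv_eq, h.eq_of_nhds]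

section

variable {M : Type*} [TopologicalSpace M] [ChartedSpace E4 M] [IsManifold (𝓡 4) ∞ M]

/-- Vector fields on `M`, without any regularity. -/
abbrev VField (M : Type*) [TopologicalSpace M] [ChartedSpace E4 M] [IsManifold (𝓡 4) ∞ M] :
    Type _ := (x : M) → TangentSpace (𝓡 4) x

/-- The vector field `X` is smooth on `U`. -/
abbrev SmoothOn (X : VField M) (U : Set M) : Prop :=
  ContMDiffOn (𝓡 4) (𝓡 4).tangent ∞ (fun y ↦ (⟨y, X y⟩ : TangentBundle (𝓡 4) M)) U

/-- The vector field `X` is differentiable at `x`. -/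
abbrev DiffAt (X : VField M) (x : M) : Prop :=
  MDifferentiableAt (𝓡 4) (𝓡 4).tangent (fun y ↦ (⟨y, X y⟩ : TangentBundle (𝓡 4) M)) x

theorem SmoothOn.diffAt {X : VField M} {U : Set M} (hX : SmoothOn X U) (hU : IsOpen U) {x : M}
    (hx : x ∈ U) : DiffAt X x :=
  (hX.contMDiffAt (hU.mem_nhds hx)).mdifferentiableAt (by simp)

/- Mathlib's lemmas on the Lie bracket ask for smoothness of the manifold in the next two forms. -/

instance isManifold_minSmoothness_two : IsManifold (𝓡 4) (minSmoothness ℝ 2) M := by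
  rw [minSmoothness_of_isRCLikeNormedField]
  infer_instance

instance isManifold_minSmoothness_three : IsManifold (𝓡 4) (minSmoothness ℝ 3) M := by
  rw [minSmoothness_of_isRCLikeNormedField]
  infer_instance

theorem SmoothOn.lieBracket {X Y : VField M} {U : Set M} (hX : SmoothOn X U) (hY : SmoothOn Y U)
    (hU : IsOpen U) : SmoothOn (mlieBracket (𝓡 4) X Y) U := fun x hx ↦ by
  have : IsManifold (𝓡 4) ((⊤ : ℕ∞) + 1) M := inferInstanceAs (IsManifold (𝓡 4) ∞ M)
  have := ContMDiffAt.mlieBracket_vectorField (m := ⊤) (n := ⊤) (hX.contMDiffAt (hU.mem_nhds hx))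
    (hY.contMDiffAt (hU.mem_nhds hx)) (by simp)
  exact this.contMDiffWithinAt

theorem LorentzMetric.smoothOn (g : LorentzMetric M) {X Y : VField M} {U : Set M}
    (hX : SmoothOn X U) (hY : SmoothOn Y U) :
    ContMDiffOn (𝓡 4) 𝓘(ℝ, ℝ) ∞ (fun y ↦ g.val y (X y) (Y y)) U := by
  have h1 := ContMDiffOn.clm_bundle_apply₂ (F₃ := ℝ) (E₃ := Bundle.Trivial M ℝ) (b := fun x : M ↦ x)
    (ψ := fun x ↦ g.val x)
    (g.contMDiff.contMDiffOn (s := U)) hX hY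
  intro x hx
  have := h1 x hx
  rw [Bundle.contMDiffWithinAt_totalSpace] at this
  exact this.2

/-- The smoothness of a connection is stated for globally smooth fields only. A field that is smooth
on `U` is cut off by a bump function, which does not change its covariant derivative near `x`. -/
theorem MetricConnection.contMDiffAt_conn [T2Space M] {g : LorentzMetric M}
    (D : MetricConnection g) {Z : VField M} {U : Set M} (hU : IsOpen U) (hZ : SmoothOn Z U)
    {x : M} (hx : x ∈ U) :
    ContMDiffAt (𝓡 4) ((𝓡 4).prod 𝓘(ℝ, E4 →L[ℝ] E4)) ∞
      (fun y ↦ (⟨y, D.conn Z y⟩ : TotalSpace (E4 →L[ℝ] E4)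
        fun y : M ↦ TangentSpace (𝓡 4) y →L[ℝ] TangentSpace (𝓡 4) y)) x := by
  obtain ⟨f, -, hfU⟩ := ((SmoothBumpFunction.nhds_basis_tsupport (I := 𝓡 4) x).mem_iff).1
    (hU.mem_nhds hx)
  have hZ' : ContMDiff (𝓡 4) (𝓡 4).tangent ∞
      (fun y ↦ (⟨y, ((f : M → ℝ) • Z) y⟩ : TangentBundle (𝓡 4) M)) :=
    ContMDiffOn.smul_section_of_tsupport f.contMDiff.contMDiffOn hU hfU hZ
  have hD := (D.smooth.contMDiff.contMDiff (σ := (f : M → ℝ) • Z) hZ'.contMDiffOn).contMDiffAt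
    (x := x) Filter.univ_mem
  refine hD.congr_of_eventuallyEq ?_
  filter_upwards [f.eventuallyEq_one.eventuallyEq_nhds, hU.mem_nhds hx] with y hy hyU
  congr 1
  refine (D.conn.isCovariantDerivativeOnUniv.congr_of_eventuallyEq
    (hZ'.mdifferentiable (by simp) y) (hZ.diffAt hU hyU) Filter.univ_mem ?_).symm
  filter_upwards [hy] with z hz
  simp [hz]

theorem MetricConnection.smoothOn [T2Space M] {g : LorentzMetric M} (D : MetricConnection g)
    {X Z : VField M} {U : Set M} (hU : IsOpen U)
    (hX : SmoothOn X U) (hZ : SmoothOn Z U) : SmoothOn (fun y ↦ D.conn Z y (X y)) U :=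
  fun _ hx ↦ (ContMDiffAt.clm_bundle_apply (b := fun x : M ↦ x) (D.contMDiffAt_conn hU hZ hx)
    (hX.contMDiffAt (hU.mem_nhds hx))).contMDiffWithinAt

theorem MetricConnection.diffAt [T2Space M] {g : LorentzMetric M} (D : MetricConnection g)
    {X Z : VField M} {U : Set M} (hU : IsOpen U) {x : M} (hx : x ∈ U)
    (hX : DiffAt X x) (hZ : SmoothOn Z U) : DiffAt (fun y ↦ D.conn Z y (X y)) x :=
  MDifferentiableAt.clm_bundle_apply (b := fun x : M ↦ x)
    ((D.contMDiffAt_conn hU hZ hx).mdifferentiableAt (by simp)) hX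

/-! ### Vector fields as derivations -/

/-- `XYf - YXf = [X,Y]f`. The Jacobi identities for `X, Y, fW` and for `X, Y, W` differ by
`(XYf - YXf - [X,Y]f) W`, so a field `W` that does not vanish at `x` suffices. -/
theorem mvfderiv_commutator {X Y W : VField M} {f : M → ℝ} {U : Set M} (hU : IsOpen U)
    (hX : SmoothOn X U) (hY : SmoothOn Y U) (hW : SmoothOn W U)
    (hf : ContMDiffOn (𝓡 4) 𝓘(ℝ, ℝ) ∞ f U) {x : M} (hx : x ∈ U) (hWx : W x ≠ 0)
    (hXf : MDifferentiableAt (𝓡 4) 𝓘(ℝ, ℝ) (fun y ↦ mvfderiv (𝓡 4) f y (X y)) x)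
    (hYf : MDifferentiableAt (𝓡 4) 𝓘(ℝ, ℝ) (fun y ↦ mvfderiv (𝓡 4) f y (Y y)) x) :
    mvfderiv (𝓡 4) (fun y ↦ mvfderiv (𝓡 4) f y (Y y)) x (X x)
      - mvfderiv (𝓡 4) (fun y ↦ mvfderiv (𝓡 4) f y (X y)) x (Y x)
      = mvfderiv (𝓡 4) f x (mlieBracket (𝓡 4) X Y x) := by
  have hfd : ∀ y ∈ U, MDifferentiableAt (𝓡 4) 𝓘(ℝ, ℝ) f y := fun y hy ↦
    (hf.contMDiffAt (hU.mem_nhds hy)).mdifferentiableAt (by simp)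
  have key : ∀ A B : VField M, SmoothOn A U → SmoothOn B U →
      MDifferentiableAt (𝓡 4) 𝓘(ℝ, ℝ) (fun y ↦ mvfderiv (𝓡 4) f y (B y)) x →
      mlieBracket (𝓡 4) A (mlieBracket (𝓡 4) B (f • W)) x
        = (mvfderiv (𝓡 4) (fun y ↦ mvfderiv (𝓡 4) f y (B y)) x (A x) • W x
          + mvfderiv (𝓡 4) f x (B x) • mlieBracket (𝓡 4) A W x)
          + (mvfderiv (𝓡 4) f x (A x) • mlieBracket (𝓡 4) B W x
          + f x • mlieBracket (𝓡 4) A (mlieBracket (𝓡 4) B W) x) := by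
    intro A B hA hB hBf
    have hE : mlieBracket (𝓡 4) B (f • W) =ᶠ[𝓝 x]
        (fun y ↦ mvfderiv (𝓡 4) f y (B y)) • W + f • mlieBracket (𝓡 4) B W := by
      filter_upwards [hU.mem_nhds hx] with y hy
      exact mlieBracket_smul_right (hfd y hy) (hW.diffAt hU hy)
    rw [(EventuallyEq.refl (𝓝 x) A).mlieBracket_vectorField_eq hE,
      mlieBracket_add_right (hBf.smul_section (hW.diffAt hU hx))
        ((hfd x hx).smul_section ((hB.lieBracket hW hU).diffAt hU hx)),
      mlieBracket_smul_right hBf (hW.diffAt hU hx),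
      mlieBracket_smul_right (hfd x hx) ((hB.lieBracket hW hU).diffAt hU hx)]
  have hs : ∀ {A : VField M}, SmoothOn A U → ContMDiffAt (𝓡 4) (𝓡 4).tangent (minSmoothness ℝ 2)
      (fun y ↦ (⟨y, A y⟩ : TangentBundle (𝓡 4) M)) x := fun hA ↦ by
    rw [minSmoothness_of_isRCLikeNormedField]
    exact (hA.contMDiffAt (hU.mem_nhds hx)).of_le (WithTop.coe_le_coe.2 le_top)
  have hfW : SmoothOn (f • W) U := hf.smul_section hW
  have j1 := leibniz_identity_mlieBracket_apply (hs hX) (hs hY) (hs hfW)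
  have j2 := leibniz_identity_mlieBracket_apply (hs hX) (hs hY) (hs hW)
  rw [key X Y hX hY hYf, key Y X hY hX hXf,
    mlieBracket_smul_right (hfd x hx) (hW.diffAt hU hx), j2] at j1
  rw [← sub_eq_zero]
  refine (smul_eq_zero.1 (?_ : _ • W x = 0)).resolve_right hWx
  rw [sub_smul, sub_smul, ← sub_eq_zero.2 j1]
  module

theorem MetricConnection.mvfderiv_metric {g : LorentzMetric M} (D : MetricConnection g)
    {Z W : VField M} {U : Set M} (hU : IsOpen U)
    (hZ : SmoothOn Z U) (hW : SmoothOn W U) {x : M} (hx : x ∈ U) (u : TangentSpace (𝓡 4) x) :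
    mvfderiv (𝓡 4) (fun y ↦ g.val y (Z y) (W y)) x u
      = g.val x (D.conn Z x u) (W x) + g.val x (Z x) (D.conn W x u) :=
  D.metric (hZ.diffAt hU hx) (hW.diffAt hU hx) u

theorem LorentzMetric.diffAt (g : LorentzMetric M) {X Y : VField M} {U : Set M} (hU : IsOpen U)
    (hX : SmoothOn X U) (hY : SmoothOn Y U) {x : M} (hx : x ∈ U) :
    MDifferentiableAt (𝓡 4) 𝓘(ℝ, ℝ) (fun y ↦ g.val y (X y) (Y y)) x :=
  ((g.smoothOn hX hY).contMDiffAt (hU.mem_nhds hx)).mdifferentiableAt (by simp)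

/-- `g(R(X,Y)Z,W) + g(Z,R(X,Y)W) = 0` for a metric connection. The nonvanishing field `V` only
serves to apply `mvfderiv_commutator`. -/
theorem MetricConnection.curvatureOp_antisymm [T2Space M] {g : LorentzMetric M}
    (D : MetricConnection g) {X Y Z W V : VField M} {U : Set M} (hU : IsOpen U)
    (hX : SmoothOn X U) (hY : SmoothOn Y U) (hZ : SmoothOn Z U) (hW : SmoothOn W U)
    (hV : SmoothOn V U) {x : M} (hx : x ∈ U) (hVx : V x ≠ 0) :
    g.val x (curvatureOp D.conn X Y Z x) (W x)
      + g.val x (Z x) (curvatureOp D.conn X Y W x) = 0 := by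
  have hd : ∀ {A : VField M}, SmoothOn A U → (fun y ↦ mvfderiv (𝓡 4)
      (fun z ↦ g.val z (Z z) (W z)) y (A y)) =ᶠ[𝓝 x]
      (fun y ↦ g.val y (D.conn Z y (A y)) (W y)) + fun y ↦ g.val y (Z y) (D.conn W y (A y)) := by
    intro A hA
    filter_upwards [hU.mem_nhds hx] with y hy
    exact D.mvfderiv_metric hU hZ hW hy _
  have hdd : ∀ {A : VField M}, SmoothOn A U → MDifferentiableAt (𝓡 4) 𝓘(ℝ, ℝ)
      ((fun y ↦ g.val y (D.conn Z y (A y)) (W y)) + fun y ↦ g.val y (Z y) (D.conn W y (A y))) x :=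
    fun hA ↦ (g.diffAt hU (D.smoothOn hU hA hZ) hW hx).add
      (g.diffAt hU hZ (D.smoothOn hU hA hW) hx)
  have h := mvfderiv_commutator hU hX hY hV (g.smoothOn hZ hW) hx hVx
    ((hdd hX).congr_of_eventuallyEq (hd hX)) ((hdd hY).congr_of_eventuallyEq (hd hY))
  have key : ∀ {A B : VField M}, SmoothOn A U → SmoothOn B U →
      mvfderiv (𝓡 4) (fun y ↦ mvfderiv (𝓡 4) (fun z ↦ g.val z (Z z) (W z)) y (A y)) x (B x)
      = (g.val x (D.conn (fun y ↦ D.conn Z y (A y)) x (B x)) (W x)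
          + g.val x (D.conn Z x (A x)) (D.conn W x (B x)))
        + (g.val x (D.conn Z x (B x)) (D.conn W x (A x))
          + g.val x (Z x) (D.conn (fun y ↦ D.conn W y (A y)) x (B x))) := by
    intro A B hA hB
    rw [mvfderiv_congr (hd hA), mvfderiv_add (g.diffAt hU (D.smoothOn hU hA hZ) hW hx)
      (g.diffAt hU hZ (D.smoothOn hU hA hW) hx)]
    have e1 := D.mvfderiv_metric hU (D.smoothOn hU hA hZ) hW hx (B x)
    have e2 := D.mvfderiv_metric hU hZ (D.smoothOn hU hA hW) hx (B x)
    simp only [_root_.add_apply]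
    rw [e1, e2]
  rw [key hX hY, key hY hX, D.mvfderiv_metric hU hZ hW hx] at h
  simp only [curvatureOp, map_sub, _root_.sub_apply]
  linear_combination h

/-! ### Curvature, torsion and the Bianchi identities -/

theorem curvatureOp_swap (D : CovariantDerivative (𝓡 4) E4 (TangentSpace (𝓡 4) : M → Type _))
    (X Y Z : VField M) (x : M) : curvatureOp D X Y Z x = -curvatureOp D Y X Z x := by
  simp only [curvatureOp]
  rw [mlieBracket_swap_apply, map_neg]
  module

/-- `R(X,Y)Z` is tensorial in `X`, with `X` required to be differentiable at `x` only. -/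
theorem MetricConnection.tensorialAt_curvatureOp [T2Space M] {g : LorentzMetric M}
    (D : MetricConnection g) {Y Z : VField M} {U : Set M} (hU : IsOpen U) {x : M} (hx : x ∈ U)
    (hZ : SmoothOn Z U) :
    TensorialAt (𝓡 4) E4 (fun X : VField M ↦ curvatureOp D.conn X Y Z x) x where
  smul {f X} hf hX := by
    have h1 : (fun y ↦ D.conn Z y ((f • X) y)) = f • fun y ↦ D.conn Z y (X y) := by
      ext1 y; simp
    simp only [curvatureOp]
    rw [h1, D.conn.isCovariantDerivativeOnUniv.leibniz (D.diffAt hU hx hX hZ) hf,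
      mlieBracket_smul_left hf hX]
    simp
    module
  add {X X'} hX hX' := by
    have h1 : (fun y ↦ D.conn Z y ((X + X') y))
        = (fun y ↦ D.conn Z y (X y)) + fun y ↦ D.conn Z y (X' y) := by
      ext1 y; simp
    simp only [curvatureOp]
    rw [h1, D.conn.isCovariantDerivativeOnUniv.add (D.diffAt hU hx hX hZ) (D.diffAt hU hx hX' hZ),
      mlieBracket_add_left hX hX']
    simp
    module

theorem SmoothOn.sub {X Y : VField M} {U : Set M} (hX : SmoothOn X U) (hY : SmoothOn Y U) :
    SmoothOn (X - Y) U := ContMDiffOn.sub_section hX hY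

theorem MetricConnection.conn_sub {g : LorentzMetric M}
    (D : MetricConnection g) {X Y : VField M} {U : Set M} (hU : IsOpen U) (hX : SmoothOn X U)
    (hY : SmoothOn Y U) {x : M} (hx : x ∈ U) :
    D.conn (X - Y) x = D.conn X x - D.conn Y x := by
  have h := D.conn.isCovariantDerivativeOnUniv.add ((hX.sub hY).diffAt hU hx) (hY.diffAt hU hx)
  rw [sub_add_cancel] at h
  exact eq_sub_of_add_eq h.symm

theorem mlieBracket_jacobi {X Y Z : VField M} {U : Set M} (hU : IsOpen U) {x : M} (hx : x ∈ U)
    (hX : SmoothOn X U) (hY : SmoothOn Y U) (hZ : SmoothOn Z U) :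
    mlieBracket (𝓡 4) X (mlieBracket (𝓡 4) Y Z) x + mlieBracket (𝓡 4) Y (mlieBracket (𝓡 4) Z X) x
      + mlieBracket (𝓡 4) Z (mlieBracket (𝓡 4) X Y) x = 0 := by
  have hs : ∀ {A : VField M}, SmoothOn A U → ContMDiffAt (𝓡 4) (𝓡 4).tangent (minSmoothness ℝ 2)
      (fun y ↦ (⟨y, A y⟩ : TangentBundle (𝓡 4) M)) x := fun hA ↦ by
    rw [minSmoothness_of_isRCLikeNormedField]
    exact (hA.contMDiffAt (hU.mem_nhds hx)).of_le (WithTop.coe_le_coe.2 le_top)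
  have h := leibniz_identity_mlieBracket_apply (hs hX) (hs hY) (hs hZ)
  have hneg : mlieBracket (𝓡 4) Y (mlieBracket (𝓡 4) X Z) x
      = -mlieBracket (𝓡 4) Y (mlieBracket (𝓡 4) Z X) x := by
    have h0 := mlieBracket_const_smul_right (I := 𝓡 4) (V := Y) (c := (-1 : ℝ))
      ((hZ.lieBracket hX hU).diffAt hU hx)
    rw [mlieBracket_swap (V := X) (W := Z)]
    simpa using h0
  rw [h, hneg, mlieBracket_swap_apply (V := mlieBracket (𝓡 4) X Y) (W := Z)]
  module

theorem MetricConnection.torsion_eq {g : LorentzMetric M} (D : MetricConnection g)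
    {X Y : VField M} {U : Set M} (hU : IsOpen U) (hX : SmoothOn X U) (hY : SmoothOn Y U)
    {x : M} (hx : x ∈ U) :
    D.conn.torsion x (X x) (Y x) = ((fun y ↦ D.conn Y y (X y)) - (fun y ↦ D.conn X y (Y y))
      - mlieBracket (𝓡 4) X Y : VField M) x :=
  D.conn.torsion_apply (hX.diffAt hU hx) (hY.diffAt hU hx)

theorem MetricConnection.smoothOn_torsion [T2Space M] {g : LorentzMetric M}
    (D : MetricConnection g) {X Y : VField M} {U : Set M} (hU : IsOpen U)
    (hX : SmoothOn X U) (hY : SmoothOn Y U) :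
    SmoothOn (fun y ↦ D.conn.torsion y (X y) (Y y)) U := by
  refine ContMDiffOn.congr (((D.smoothOn hU hX hY).sub (D.smoothOn hU hY hX)).sub
    (hX.lieBracket hY hU)) fun y hy ↦ ?_
  exact congrArg (TotalSpace.mk' E4 y) (D.torsion_eq hU hX hY hy)

theorem MetricConnection.smoothOn_curvatureOp [T2Space M] {g : LorentzMetric M}
    (D : MetricConnection g) {X Y Z : VField M} {U : Set M} (hU : IsOpen U)
    (hX : SmoothOn X U) (hY : SmoothOn Y U) (hZ : SmoothOn Z U) :
    SmoothOn (curvatureOp D.conn X Y Z) U :=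
  ((D.smoothOn hU hX (D.smoothOn hU hY hZ)).sub (D.smoothOn hU hY (D.smoothOn hU hX hZ))).sub
    (D.smoothOn hU (hX.lieBracket hY hU) hZ)

theorem MetricConnection.conn_torsion [T2Space M] {g : LorentzMetric M}
    (D : MetricConnection g) {X Y : VField M} {U : Set M} (hU : IsOpen U)
    (hX : SmoothOn X U) (hY : SmoothOn Y U) {x : M} (hx : x ∈ U) (u : TangentSpace (𝓡 4) x) :
    D.conn (fun y ↦ D.conn.torsion y (X y) (Y y)) x u
      = D.conn (fun y ↦ D.conn Y y (X y)) x u - D.conn (fun y ↦ D.conn X y (Y y)) x u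
        - D.conn (mlieBracket (𝓡 4) X Y) x u := by
  have h1 := D.smoothOn hU hX hY
  have h2 := D.smoothOn hU hY hX
  have h3 := hX.lieBracket hY hU
  rw [D.conn.isCovariantDerivativeOnUniv.congr_of_eventuallyEq
      ((D.smoothOn_torsion hU hX hY).diffAt hU hx) (((h1.sub h2).sub h3).diffAt hU hx)
      Filter.univ_mem
      (by filter_upwards [hU.mem_nhds hx] with y hy using D.torsion_eq hU hX hY hy),
    D.conn_sub hU (h1.sub h2) h3 hx, D.conn_sub hU h1 h2 hx]
  rfl

/-- The first Bianchi identity of a connection with torsion. The cyclic summand `S` is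
`D_X (T(Y,Z)) - T(D_X Y,Z) - T(Y,D_X Z) - T(T(X,Z),Y)`. -/
theorem MetricConnection.first_bianchi [T2Space M] {g : LorentzMetric M}
    (D : MetricConnection g) {X Y Z : VField M} {U : Set M} (hU : IsOpen U)
    (hX : SmoothOn X U) (hY : SmoothOn Y U) (hZ : SmoothOn Z U) {x : M} (hx : x ∈ U)
    (S : VField M → VField M → VField M → TangentSpace (𝓡 4) x)
    (hS : ∀ X Y Z : VField M, S X Y Z = D.conn (fun y ↦ D.conn.torsion y (Y y) (Z y)) x (X x)
      - D.conn.torsion x (D.conn Y x (X x)) (Z x) - D.conn.torsion x (Y x) (D.conn Z x (X x))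
      - D.conn.torsion x (D.conn.torsion x (X x) (Z x)) (Y x)) :
    curvatureOp D.conn Y Z X x + curvatureOp D.conn Z X Y x + curvatureOp D.conn X Y Z x
      = S X Y Z + S Y Z X + S Z X Y := by
  have ht : ∀ {A B C : VField M}, SmoothOn A U → SmoothOn B U → SmoothOn C U →
      D.conn.torsion x (D.conn.torsion x (A x) (C x)) (B x)
        = D.conn.torsion x (D.conn C x (A x)) (B x) - D.conn.torsion x (D.conn A x (C x)) (B x)
          - D.conn.torsion x (mlieBracket (𝓡 4) A C x) (B x) := fun hA hB hC ↦ by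
    rw [D.conn.torsion_apply (hA.diffAt hU hx) (hC.diffAt hU hx)]
    simp
  -- The terms `D_A [B,C]` left over by the torsion are exchanged for `D_{[B,C]} A`.
  have hb : ∀ {A B C : VField M}, SmoothOn A U → SmoothOn B U → SmoothOn C U →
      D.conn (mlieBracket (𝓡 4) B C) x (A x) = D.conn A x (mlieBracket (𝓡 4) B C x)
        + mlieBracket (𝓡 4) A (mlieBracket (𝓡 4) B C) x
        - D.conn.torsion x (mlieBracket (𝓡 4) B C x) (A x) := fun hA hB hC ↦ by
    rw [D.conn.torsion_antisymm,
      D.conn.torsion_apply (hA.diffAt hU hx) ((hB.lieBracket hC hU).diffAt hU hx)]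
    module
  have hj := mlieBracket_jacobi hU hx hX hY hZ
  simp only [hS]
  rw [D.conn_torsion hU hX hY hx, D.conn_torsion hU hY hZ hx, D.conn_torsion hU hZ hX hx,
    ht hX hY hZ, ht hY hZ hX, ht hZ hX hY, hb hX hY hZ, hb hY hZ hX, hb hZ hX hY,
    D.conn.torsion_antisymm (X x) (D.conn Y x (Z x)),
    D.conn.torsion_antisymm (Y x) (D.conn Z x (X x)),
    D.conn.torsion_antisymm (Z x) (D.conn X x (Y x)),
    mlieBracket_swap_apply (V := X) (W := Z), mlieBracket_swap_apply (V := Y) (W := X),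
    mlieBracket_swap_apply (V := Z) (W := Y)]
  simp only [curvatureOp, map_neg, _root_.neg_apply]
  linear_combination (norm := module) hj

/-- The second Bianchi identity of a connection with torsion, applied to a fixed field `B`. Here
`R C v` is `R(v,C)B` at `x` as a linear function of the tangent vector `v`, and the cyclic summand
`S` is the covariant derivative `(D_X R)(Y,Z)B`, with `R(Y,D_X Z)` rewritten as `-R(D_X Z,Y)`. -/
theorem MetricConnection.second_bianchi [T2Space M] {g : LorentzMetric M}
    (D : MetricConnection g) {X Y Z B : VField M} {U : Set M} (hU : IsOpen U)
    (hX : SmoothOn X U) (hY : SmoothOn Y U) (hZ : SmoothOn Z U) (hB : SmoothOn B U)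
    {x : M} (hx : x ∈ U)
    (R : VField M → TangentSpace (𝓡 4) x →L[ℝ] TangentSpace (𝓡 4) x)
    (hR : ∀ A C : VField M, SmoothOn A U → SmoothOn C U →
      R C (A x) = curvatureOp D.conn A C B x)
    (S : VField M → VField M → VField M → TangentSpace (𝓡 4) x)
    (hS : ∀ X Y Z : VField M, S X Y Z = D.conn (curvatureOp D.conn Y Z B) x (X x)
      - R Z (D.conn Y x (X x)) + R Y (D.conn Z x (X x))
      - curvatureOp D.conn Y Z (fun y ↦ D.conn B y (X y)) x) :
    S X Y Z + S Y Z X + S Z X Y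
      = -(R Z (D.conn.torsion x (X x) (Y x)) + R X (D.conn.torsion x (Y x) (Z x))
        + R Y (D.conn.torsion x (Z x) (X x))) := by
  -- The last three terms are `-D_E D_{[A,C]} B`, commuted with the help of `R(E,[A,C])B`.
  have hc : ∀ {A C E : VField M}, SmoothOn A U → SmoothOn C U → SmoothOn E U →
      D.conn (curvatureOp D.conn A C B) x (E x)
        = D.conn (fun z ↦ D.conn (fun y ↦ D.conn B y (C y)) z (A z)) x (E x)
          - D.conn (fun z ↦ D.conn (fun y ↦ D.conn B y (A y)) z (C z)) x (E x)
          + R E (mlieBracket (𝓡 4) A C x)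
          - D.conn (fun y ↦ D.conn B y (E y)) x (mlieBracket (𝓡 4) A C x)
          - D.conn B x (mlieBracket (𝓡 4) E (mlieBracket (𝓡 4) A C) x) := fun {A C E} hA hC hE ↦ by
    have h1 := D.smoothOn hU hA (D.smoothOn hU hC hB)
    have h2 := D.smoothOn hU hC (D.smoothOn hU hA hB)
    have h3 := D.smoothOn hU (hA.lieBracket hC hU) hB
    have h4 : curvatureOp D.conn A C B = (fun z ↦ D.conn (fun y ↦ D.conn B y (C y)) z (A z))
      - (fun z ↦ D.conn (fun y ↦ D.conn B y (A y)) z (C z))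
      - fun z ↦ D.conn B z (mlieBracket (𝓡 4) A C z) := rfl
    rw [hR _ _ (hA.lieBracket hC hU) hE, curvatureOp_swap, h4, D.conn_sub hU (h1.sub h2) h3 hx,
      D.conn_sub hU h1 h2 hx]
    simp only [curvatureOp, _root_.sub_apply]
    module
  have ht : ∀ {A C : VField M} (E : VField M), SmoothOn A U → SmoothOn C U →
      R E (D.conn.torsion x (A x) (C x))
        = R E (D.conn C x (A x)) - R E (D.conn A x (C x)) - R E (mlieBracket (𝓡 4) A C x) :=
    fun E hA hC ↦ by
      rw [D.conn.torsion_apply (hA.diffAt hU hx) (hC.diffAt hU hx), map_sub, map_sub]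
  have hj := congrArg (D.conn B x) (mlieBracket_jacobi hU hx hX hY hZ)
  simp only [map_add, map_zero] at hj
  simp only [hS]
  rw [hc hY hZ hX, hc hZ hX hY, hc hX hY hZ, ht Z hX hY, ht X hY hZ, ht Y hZ hX]
  simp only [curvatureOp]
  linear_combination (norm := module) -hj

/-! ### Components in a moving frame -/

namespace MovingFrame

theorem smoothOn (e : MovingFrame M) (i : Fin 4) : SmoothOn (e.vec i) e.dom :=
  e.isFrame.contMDiffOn i

theorem vec_ne_zero (e : MovingFrame M) {x : M} (hx : x ∈ e.dom) (i : Fin 4) : e.vec i x ≠ 0 :=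
  (e.isFrame.linearIndependent hx).ne_zero i

theorem sum_theta_smul (e : MovingFrame M) {x : M} (hx : x ∈ e.dom) (v : TangentSpace (𝓡 4) x) :
    ∑ σ, e.theta σ x v • e.vec σ x = v := by
  have h := (e.isFrame.toBasisAt hx).sum_repr v
  simpa [theta, IsLocalFrameOn.coeff, hx] using h

theorem sum_theta_mul (e : MovingFrame M) {x : M} (hx : x ∈ e.dom) (v : TangentSpace (𝓡 4) x)
    (φ : TangentSpace (𝓡 4) x → ℝ) (hφ : IsLinearMap ℝ φ) :
    ∑ σ, e.theta σ x v * φ (e.vec σ x) = φ v := by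
  have h := congrArg (hφ.mk' φ) (e.sum_theta_smul hx v)
  simpa using h

end MovingFrame

theorem LorentzMetric.sum_down_theta (g : LorentzMetric M) (e : MovingFrame M) {x : M}
    (hx : x ∈ e.dom) (ρ : Fin 4) (v : TangentSpace (𝓡 4) x) :
    ∑ σ, g.down e x ρ σ * e.theta σ x v = g.val x (e.vec ρ x) v := by
  rw [← e.sum_theta_mul hx v (fun w ↦ g.val x (e.vec ρ x) w) ⟨by simp, by simp⟩]
  exact Finset.sum_congr rfl fun σ _ ↦ mul_comm _ _

variable {g : LorentzMetric M}

namespace MetricConnection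

variable (D : MetricConnection g) (e : MovingFrame M)

theorem lower3_tor {x : M} (hx : x ∈ e.dom) (ρ α β : Fin 4) :
    lower3 g e (D.tor e) x ρ α β
      = g.val x (e.vec ρ x) (D.conn.torsion x (e.vec α x) (e.vec β x)) :=
  g.sum_down_theta e hx ρ _

theorem lower4_curv {x : M} (hx : x ∈ e.dom) (μ ρ α β : Fin 4) :
    lower4 g e (D.curv e) x μ ρ α β
      = g.val x (e.vec ρ x) (curvatureOp D.conn (e.vec α) (e.vec β) (e.vec μ) x) :=
  g.sum_down_theta e hx ρ _

theorem cov3_lower3_tor [T2Space M] {x : M} (hx : x ∈ e.dom) (μ ρ α β : Fin 4) :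
    D.cov3 e (lower3 g e (D.tor e)) x μ ρ α β
      = g.val x (e.vec ρ x)
        (D.conn (fun y ↦ D.conn.torsion y (e.vec α y) (e.vec β y)) x (e.vec μ x)
          - D.conn.torsion x (D.conn (e.vec α) x (e.vec μ x)) (e.vec β x)
          - D.conn.torsion x (e.vec α x) (D.conn (e.vec β) x (e.vec μ x))) := by
  have hT := D.smoothOn_torsion e.isOpen_dom (e.smoothOn α) (e.smoothOn β)
  have h1 : mvfderiv (𝓡 4) (fun y ↦ lower3 g e (D.tor e) y ρ α β) x
      = mvfderiv (𝓡 4) (fun y ↦ g.val y (e.vec ρ y)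
        (D.conn.torsion y (e.vec α y) (e.vec β y))) x := mvfderiv_congr <| by
    filter_upwards [e.isOpen_dom.mem_nhds hx] with y hy using D.lower3_tor e hy ρ α β
  have c1 := e.sum_theta_mul hx (D.conn (e.vec ρ) x (e.vec μ x))
    (fun w ↦ g.val x w (D.conn.torsion x (e.vec α x) (e.vec β x))) ⟨by simp, by simp⟩
  have c2 := e.sum_theta_mul hx (D.conn (e.vec α) x (e.vec μ x))
    (fun w ↦ g.val x (e.vec ρ x) (D.conn.torsion x w (e.vec β x))) ⟨by simp, by simp⟩
  have c3 := e.sum_theta_mul hx (D.conn (e.vec β) x (e.vec μ x))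
    (fun w ↦ g.val x (e.vec ρ x) (D.conn.torsion x (e.vec α x) w)) ⟨by simp, by simp⟩
  have m := D.mvfderiv_metric e.isOpen_dom (e.smoothOn ρ) hT hx (e.vec μ x)
  simp only [cov3, h1, m, coef, D.lower3_tor e hx, Finset.sum_add_distrib, c1, c2, c3, map_sub]
  ring

/-- The first Bianchi identity in components. -/
theorem first_bianchi_components [T2Space M] {x : M} (hx : x ∈ e.dom) (μ ρ α β : Fin 4) :
    cyc3 (fun μ α β ↦ lower4 g e (D.curv e) x μ ρ α β) μ α β
      = torsionSide D e (D.tor e) x μ ρ α β := by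
  have h := congrArg (g.val x (e.vec ρ x)) (D.first_bianchi e.isOpen_dom (e.smoothOn μ)
    (e.smoothOn α) (e.smoothOn β) hx _ (fun _ _ _ ↦ rfl))
  have c : ∀ μ α β, ∑ κ, D.tor e x κ μ β * lower3 g e (D.tor e) x ρ κ α
      = g.val x (e.vec ρ x) (D.conn.torsion x (D.conn.torsion x (e.vec μ x) (e.vec β x))
          (e.vec α x)) := fun μ α β ↦ by
    have := e.sum_theta_mul hx (D.conn.torsion x (e.vec μ x) (e.vec β x))
      (fun w ↦ g.val x (e.vec ρ x) (D.conn.torsion x w (e.vec α x))) ⟨by simp, by simp⟩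
    simp only [D.lower3_tor e hx]
    exact this
  simp only [cyc3, torsionSide, D.lower4_curv e hx, D.cov3_lower3_tor e hx, c]
  simp only [map_add, map_sub] at h ⊢
  linear_combination h

/-- `R_{μραβ} = -R_{ρμαβ}`: the curvature of a metric connection is skew-adjoint. -/
theorem lower4_curv_antisymm [T2Space M] {x : M} (hx : x ∈ e.dom) (μ ρ α β : Fin 4) :
    lower4 g e (D.curv e) x ρ μ α β = -lower4 g e (D.curv e) x μ ρ α β := by
  have h := D.curvatureOp_antisymm e.isOpen_dom (e.smoothOn α) (e.smoothOn β) (e.smoothOn μ)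
    (e.smoothOn ρ) (e.smoothOn 0) hx (e.vec_ne_zero hx 0)
  rw [g.symm x _ (e.vec ρ x)] at h
  rw [D.lower4_curv e hx, D.lower4_curv e hx]
  linear_combination h

/-- `R(v,C)B` at `x` as a linear function of the tangent vector `v`, for every smooth `C`. -/
theorem exists_curvatureOp_linear [T2Space M] {B : VField M} {U : Set M} (hU : IsOpen U)
    (hB : SmoothOn B U) {x : M} (hx : x ∈ U) :
    ∃ R : VField M → TangentSpace (𝓡 4) x →L[ℝ] TangentSpace (𝓡 4) x,
      ∀ A C : VField M, SmoothOn A U → SmoothOn C U → R C (A x) = curvatureOp D.conn A C B x := by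
  classical
  refine ⟨fun C ↦ if hC : SmoothOn C U then
    TensorialAt.mkHom _ x (D.tensorialAt_curvatureOp (Y := C) hU hx hB) else 0, fun A C hA hC ↦ ?_⟩
  simp only [hC, dif_pos]
  exact TensorialAt.mkHom_apply _ (hA.diffAt hU hx)

/-- The second Bianchi identity in components. -/
theorem second_bianchi_components [T2Space M] {x : M} (hx : x ∈ e.dom) (β α μ ν ρ : Fin 4) :
    cyc3 (fun μ ν ρ ↦ D.cov4 e (lower4 g e (D.curv e)) x μ β α ν ρ) μ ν ρ
      = torsionCurvatureSide g e (D.tor e) (D.curv e) x β α μ ν ρ := by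
  have hU := e.isOpen_dom
  have hB := e.smoothOn β
  obtain ⟨R, hR⟩ := D.exists_curvatureOp_linear hU hB hx
  have hRe : ∀ a b, R (e.vec b) (e.vec a x) = curvatureOp D.conn (e.vec a) (e.vec b) (e.vec β) x :=
    fun a b ↦ hR _ _ (e.smoothOn a) (e.smoothOn b)
  have h := congrArg (g.val x (e.vec α x)) (D.second_bianchi hU (e.smoothOn μ)
    (e.smoothOn ν) (e.smoothOn ρ) hB hx R hR _ (fun _ _ _ ↦ rfl))
  have hc : ∀ μ ν ρ, D.cov4 e (lower4 g e (D.curv e)) x μ β α ν ρ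
      = g.val x (e.vec α x) (D.conn (curvatureOp D.conn (e.vec ν) (e.vec ρ) (e.vec β)) x (e.vec μ x)
        - R (e.vec ρ) (D.conn (e.vec ν) x (e.vec μ x))
        + R (e.vec ν) (D.conn (e.vec ρ) x (e.vec μ x))
        - curvatureOp D.conn (e.vec ν) (e.vec ρ)
            (fun y ↦ D.conn (e.vec β) y (e.vec μ y)) x) := fun μ ν ρ ↦ by
    have h1 : mvfderiv (𝓡 4) (fun y ↦ lower4 g e (D.curv e) y β α ν ρ) x
        = mvfderiv (𝓡 4) (fun y ↦ g.val y (e.vec α y)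
          (curvatureOp D.conn (e.vec ν) (e.vec ρ) (e.vec β) y)) x := mvfderiv_congr <| by
      filter_upwards [hU.mem_nhds hx] with y hy using D.lower4_curv e hy β α ν ρ
    have m := D.mvfderiv_metric hU (e.smoothOn α) (D.smoothOn_curvatureOp hU (e.smoothOn ν)
      (e.smoothOn ρ) hB) hx (e.vec μ x)
    have cα : ∑ σ, D.coef e x σ μ α * lower4 g e (D.curv e) x β σ ν ρ
        = g.val x (D.conn (e.vec α) x (e.vec μ x))
          (curvatureOp D.conn (e.vec ν) (e.vec ρ) (e.vec β) x) := by
      simp only [D.lower4_curv e hx]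
      exact e.sum_theta_mul hx _ (fun w ↦ g.val x w _) ⟨by simp, by simp⟩
    -- `curvatureOp` is a pointwise operation in its first two fields only. In the third one the
    -- contraction is moved to the other side of the metric by skew-adjointness.
    have cβ : ∑ σ, D.coef e x σ μ β * lower4 g e (D.curv e) x σ α ν ρ
        = g.val x (e.vec α x) (curvatureOp D.conn (e.vec ν) (e.vec ρ)
            (fun y ↦ D.conn (e.vec β) y (e.vec μ y)) x) := by
      have h2 := D.curvatureOp_antisymm hU (e.smoothOn ν) (e.smoothOn ρ) (e.smoothOn α)
        (D.smoothOn hU (e.smoothOn μ) hB) (e.smoothOn 0) hx (e.vec_ne_zero hx 0)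
      have h3 := e.sum_theta_mul hx (D.conn (e.vec β) x (e.vec μ x)) (fun w ↦ g.val x
        (curvatureOp D.conn (e.vec ν) (e.vec ρ) (e.vec α) x) w) ⟨by simp, by simp⟩
      have h4 : ∀ σ, lower4 g e (D.curv e) x σ α ν ρ
          = -g.val x (curvatureOp D.conn (e.vec ν) (e.vec ρ) (e.vec α) x) (e.vec σ x) :=
        fun σ ↦ by rw [D.lower4_curv_antisymm e hx, D.lower4_curv e hx, g.symm]
      simp only [h4, mul_neg, Finset.sum_neg_distrib]
      refine (congrArg Neg.neg h3).trans ?_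
      linear_combination -h2
    have cν : ∑ σ, D.coef e x σ μ ν * lower4 g e (D.curv e) x β α σ ρ
        = g.val x (e.vec α x) (R (e.vec ρ) (D.conn (e.vec ν) x (e.vec μ x))) := by
      simp only [D.lower4_curv e hx, ← hRe]
      exact e.sum_theta_mul hx _ (fun w ↦ g.val x _ (R (e.vec ρ) w)) ⟨by simp, by simp⟩
    have cρ : ∑ σ, D.coef e x σ μ ρ * lower4 g e (D.curv e) x β α ν σ
        = -g.val x (e.vec α x) (R (e.vec ν) (D.conn (e.vec ρ) x (e.vec μ x))) := by
      simp only [D.lower4_curv e hx]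
      rw [← e.sum_theta_mul hx _ (fun w ↦ g.val x (e.vec α x) (R (e.vec ν) w)) ⟨by simp, by simp⟩,
        ← Finset.sum_neg_distrib]
      refine Finset.sum_congr rfl fun σ _ ↦ ?_
      rw [curvatureOp_swap, ← hRe, map_neg, mul_neg]
      rfl
    simp only [cov4, h1, m, Finset.sum_add_distrib, cα, cβ, cν, cρ, map_sub, map_add]
    ring
  have ht : ∀ μ ν ρ, ∑ κ, D.tor e x κ ν μ * lower4 g e (D.curv e) x β α κ ρ
      = -g.val x (e.vec α x) (R (e.vec ρ) (D.conn.torsion x (e.vec μ x) (e.vec ν x))) :=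
    fun μ ν ρ ↦ by
      simp only [D.lower4_curv e hx, ← hRe]
      rw [D.conn.torsion_antisymm, map_neg, map_neg, neg_neg]
      exact e.sum_theta_mul hx _ (fun w ↦ g.val x (e.vec α x) (R (e.vec ρ) w)) ⟨by simp, by simp⟩
  simp only [torsionCurvatureSide, cyc3, hc, ht]
  simp only [map_add, map_sub, map_neg] at h ⊢
  linear_combination h

end MetricConnection

/-! ### The metric and the volume form in a moving frame -/

theorem VolumeForm.eps_eq (τ : VolumeForm g) (e : MovingFrame M) {x : M} (hx : x ∈ e.dom)
    (a b c d : Fin 4) : τ.eps e x a b c d = τ.eps e x 0 1 2 3 * levi a b c d := by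
  set B := e.isFrame.toBasisAt hx
  have hBe : ∀ i, B i = e.vec i x := e.isFrame.toBasisAt_coe hx
  have h0 : τ.val x B = τ.eps e x 0 1 2 3 := by
    unfold VolumeForm.eps
    congr 1
    ext1 i
    rw [hBe]
    fin_cases i <;> rfl
  have h := congrArg (fun f ↦ f ![e.vec a x, e.vec b x, e.vec c x, e.vec d x])
    ((τ.val x).eq_smul_basis_det B)
  have h' : τ.eps e x a b c d
      = τ.val x B * B.det ![e.vec a x, e.vec b x, e.vec c x, e.vec d x] := h
  rw [h', h0, Module.Basis.det_apply, levi_eq_det, ← Matrix.det_transpose]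
  congr 2
  ext i j
  have key : ∀ k, B.repr (e.vec k x) j = (Pi.single k 1 : Fin 4 → ℝ) j := fun k ↦ by
    rw [← hBe, B.repr_self, Finsupp.single_eq_pi_single]
  fin_cases i
  exacts [key a, key b, key c, key d]

theorem LorentzMetric.isSymm_down (g : LorentzMetric M) (e : MovingFrame M) (x : M) :
    (g.down e x).IsSymm := by
  ext i j
  exact g.symm x _ _

theorem LorentzMetric.isSymm_up (g : LorentzMetric M) (e : MovingFrame M) (x : M) :
    (g.up e x).IsSymm := by
  unfold LorentzMetric.up
  rw [Matrix.IsSymm, Matrix.transpose_nonsing_inv, (g.isSymm_down e x).eq]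

theorem LorentzMetric.det_down_neg (g : LorentzMetric M) (e : MovingFrame M) {x : M}
    (hx : x ∈ e.dom) : (g.down e x).det < 0 := by
  obtain ⟨b, hb⟩ := g.signature x
  set B := e.isFrame.toBasisAt hx
  have hBe : ∀ i, B i = e.vec i x := e.isFrame.toBasisAt_coe hx
  -- Sylvester: `g_{μν} = Pᵀ η P` with `P` the change to an orthonormal basis
  have hdown : g.down e x
      = (b.toMatrix B).transpose * Matrix.diagonal ![(1 : ℝ), -1, -1, -1] * b.toMatrix B := by
    ext i j
    have h : g.val x (B i) (B j) = ∑ l, b.repr (B j) l * ∑ k, b.repr (B i) k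
        * Matrix.diagonal ![(1 : ℝ), -1, -1, -1] k l := by
      conv_lhs => rw [← b.sum_repr (B i), ← b.sum_repr (B j)]
      simp [hb, -Module.Basis.sum_repr]
    have h' : g.down e x i j = g.val x (B i) (B j) := by rw [hBe, hBe]; rfl
    rw [h', h, Matrix.mul_apply]
    refine Finset.sum_congr rfl fun l _ ↦ ?_
    rw [Matrix.mul_apply, mul_comm]
    rfl
  have hu : (b.toMatrix B).det ≠ 0 := by
    rw [← Module.Basis.det_apply]
    exact (b.isUnit_det B).ne_zero
  rw [hdown, Matrix.det_mul, Matrix.det_mul, Matrix.det_transpose, Matrix.det_diagonal]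
  simp only [Fin.prod_univ_four, Matrix.cons_val]
  nlinarith [sq_pos_of_ne_zero hu]

theorem LorentzMetric.down_mul_up (g : LorentzMetric M) (e : MovingFrame M) {x : M}
    (hx : x ∈ e.dom) : g.down e x * g.up e x = 1 :=
  Matrix.mul_nonsing_inv _ (g.det_down_neg e hx).ne.isUnit

theorem LorentzMetric.up_mul_down (g : LorentzMetric M) (e : MovingFrame M) {x : M}
    (hx : x ∈ e.dom) : g.up e x * g.down e x = 1 :=
  Matrix.nonsing_inv_mul _ (g.det_down_neg e hx).ne.isUnit

/-- `ε₀₁₂₃² det(g^{μν}) = -1`, the sign being that of `det g`. -/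
theorem VolumeForm.eps_sq (τ : VolumeForm g) (e : MovingFrame M) {x : M} (hx : x ∈ e.dom) :
    τ.eps e x 0 1 2 3 ^ 2 * (g.up e x).det = -1 := by
  have hd := g.det_down_neg e hx
  have h : τ.eps e x 0 1 2 3 ^ 2 = -(g.down e x).det := by
    rw [← abs_of_neg hd, VolumeForm.eps, τ.sq_val]
    congr 2
    ext i j
    fin_cases i <;> fin_cases j <;> rfl
  have h2 := congrArg Matrix.det (g.down_mul_up e hx)
  rw [Matrix.det_mul, Matrix.det_one] at h2
  rw [h]
  linear_combination -h2

theorem VolumeForm.eps_ne_zero (τ : VolumeForm g) (e : MovingFrame M) {x : M} (hx : x ∈ e.dom) :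
    τ.eps e x 0 1 2 3 ≠ 0 := fun h ↦ by
  have := τ.eps_sq e hx
  simp [h] at this

/-! ### Dual curvature and Ricci contraction -/

theorem hodge2_eq_dualForm (τ : VolumeForm g) (e : MovingFrame M) {x : M} (hx : x ∈ e.dom)
    (F : Fin 4 → Fin 4 → ℝ) :
    hodge2 τ e x F = dualForm (g.up e x) (τ.eps e x 0 1 2 3) F := by
  ext α β
  simp only [hodge2, dualForm]
  simp_rw [← τ.eps_eq e hx]

theorem star4_swap (τ : VolumeForm g) (e : MovingFrame M) {x : M} (hx : x ∈ e.dom)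
    (A : CurvatureComponents M) (μ ρ α β : Fin 4) :
    star4 τ e A x μ ρ β α = -star4 τ e A x μ ρ α β := by
  simp only [star4, hodge2_eq_dualForm τ e hx]
  exact dualForm_swap ..

theorem star4_star4 (τ : VolumeForm g) (e : MovingFrame M) {x : M} (hx : x ∈ e.dom)
    (A : CurvatureComponents M) (hA : ∀ μ ρ α β, A x μ ρ β α = -A x μ ρ α β) (μ ρ α β : Fin 4) :
    star4 τ e (star4 τ e A) x μ ρ α β = -A x μ ρ α β := by
  simp only [star4, hodge2_eq_dualForm τ e hx]
  exact dualForm_dualForm _ (g.isSymm_up e x) _ (τ.eps_sq e hx) _ (hA μ ρ) α β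

/-- The cyclic sum of `A^⋆_{μrls}` over `rls` is `ε_{rlsk} A_μ^k`, with `A_{μν}` the Ricci
contraction of `A`. -/
theorem cyc3_lower4_star4 (τ : VolumeForm g) (e : MovingFrame M) {x : M} (hx : x ∈ e.dom)
    (A : CurvatureComponents M) (hA : ∀ μ ρ α β, A x μ ρ β α = -A x μ ρ α β) (μ r l s : Fin 4) :
    cyc3 (fun r l s ↦ lower4 g e (star4 τ e A) x μ r l s) r l s
      = ∑ k, τ.eps e x r l s k * ∑ n, ricci A x μ n * g.up e x n k := by
  have h := cyc3_dualForm (g.down e x) (g.up e x)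
    (by rw [(g.isSymm_down e x).eq]; exact g.down_mul_up e hx)
    (g.isSymm_up e x) (τ.eps e x 0 1 2 3) (A x μ) (hA μ) r l s
  simp only [τ.eps_eq e hx r l s]
  simp only [lower4, star4, hodge2_eq_dualForm τ e hx]
  exact h

theorem eq_of_mul_up_eq (e : MovingFrame M) {x : M} (hx : x ∈ e.dom) (X Y : Fin 4 → ℝ)
    (h : ∀ k, ∑ n, X n * g.up e x n k = ∑ n, Y n * g.up e x n k) : X = Y := by
  have h' : Matrix.vecMul X (g.up e x) = Matrix.vecMul Y (g.up e x) := funext h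
  have h2 := congrArg (fun v ↦ Matrix.vecMul v (g.down e x)) h'
  simpa [Matrix.vecMul_vecMul, g.up_mul_down e hx] using h2

/-- The cyclic identity for `A^⋆` with source `t` says that the Ricci contraction of `A` is `t`. -/
theorem ricci_eq_of_cyc3_eq (τ : VolumeForm g) (e : MovingFrame M) {x : M} (hx : x ∈ e.dom)
    (A : CurvatureComponents M) (hA : ∀ μ ρ α β, A x μ ρ β α = -A x μ ρ α β) (t : TwoTensor M)
    (μ : Fin 4) (h : ∀ r l s, cyc3 (fun r l s ↦ lower4 g e (star4 τ e A) x μ r l s) r l s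
      = epsMixed τ t e x r l s μ) : ricci A x μ = TwoTensor.down t e x μ := by
  refine eq_of_mul_up_eq (g := g) e hx _ _ (congrFun
    (eq_of_sum_levi_eq _ (τ.eps_ne_zero e hx) _ _ fun r l s ↦ ?_))
  have := h r l s
  rw [cyc3_lower4_star4 τ e hx A hA] at this
  simpa only [epsMixed, TwoTensor.mixed, τ.eps_eq e hx r l s] using this

theorem scalar_eq_trace (e : MovingFrame M) {x : M}
    (A : CurvatureComponents M) (t : TwoTensor M)
    (h : ∀ μ, ricci A x μ = TwoTensor.down t e x μ) :
    scalar g e A x = TwoTensor.trace g t e x := by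
  simp only [scalar, TwoTensor.trace, TwoTensor.mixed, h]
  refine Finset.sum_congr rfl fun μ _ ↦ Finset.sum_congr rfl fun ν _ ↦ ?_
  rw [(g.isSymm_up e x).apply, mul_comm]

theorem scalar_eq_zero_of_einstein_eq_ricci (e : MovingFrame M) {x : M} (hx : x ∈ e.dom)
    (A : CurvatureComponents M) (h : ∀ μ ν, einstein g e A x μ ν = ricci A x μ ν) :
    scalar g e A x = 0 := by
  by_contra hs
  have hz : g.down e x = 0 := by
    ext μ ν
    have := h μ ν
    simp only [einstein] at this
    have h2 : g.down e x μ ν * scalar g e A x = 0 := by linear_combination -2 * this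
    exact (mul_eq_zero.1 h2).resolve_right hs
  have := g.det_down_neg e hx
  simp [hz] at this

theorem MetricConnection.curv_swap (D : MetricConnection g) (e : MovingFrame M) (x : M)
    (μ ρ α β : Fin 4) : D.curv e x μ ρ β α = -D.curv e x μ ρ α β := by
  simp only [MetricConnection.curv, MovingFrame.theta]
  rw [curvatureOp_swap, map_neg]

/-- Mixed components and trace of `t = θ - ½ c g`. -/
theorem mixed_and_trace_of_down_eq (e : MovingFrame M) {x : M} (hx : x ∈ e.dom) (t θ : TwoTensor M)
    (c : ℝ) (h : ∀ μ ν, TwoTensor.down t e x μ ν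
      = TwoTensor.down θ e x μ ν - 1 / 2 * g.down e x μ ν * c) :
    (∀ μ κ, TwoTensor.mixed g t e x μ κ
      = TwoTensor.mixed g θ e x μ κ - 1 / 2 * c * if μ = κ then 1 else 0) ∧
    TwoTensor.trace g t e x = TwoTensor.trace g θ e x - 2 * c := by
  have hm : ∀ μ κ, TwoTensor.mixed g t e x μ κ
      = TwoTensor.mixed g θ e x μ κ - 1 / 2 * c * if μ = κ then 1 else 0 := fun μ κ ↦ by
    have hδ : ∑ ν, g.down e x μ ν * g.up e x ν κ = if μ = κ then 1 else 0 := by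
      have := congrFun (congrFun (g.down_mul_up e hx) μ) κ
      simpa [Matrix.mul_apply, Matrix.one_apply] using this
    rw [← hδ]
    simp only [TwoTensor.mixed, h, Finset.mul_sum, ← Finset.sum_sub_distrib]
    exact Finset.sum_congr rfl fun ν _ ↦ by ring
  refine ⟨hm, ?_⟩
  simp only [TwoTensor.trace, hm, if_true, Finset.sum_sub_distrib]
  simp
  ring

/-- The Ricci contraction of the dual curvature is `Θ`: as `R_{μραβ} = -R_{ρμαβ} = R^{⋆⋆}_{ρμαβ}`,
the cyclic identity with source `Θ` is one for the dual of `R^⋆`. -/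
theorem ricci_star4_eq [T2Space M] {τ : VolumeForm g} {D : MetricConnection g}
    {T Θ : TwoTensor M} (hpost : PostulatedEquations τ D T Θ) (e : MovingFrame M) {x : M}
    (hx : x ∈ e.dom) (ρ : Fin 4) :
    ricci (star4 τ e (D.curv e)) x ρ = TwoTensor.down Θ e x ρ := by
  refine ricci_eq_of_cyc3_eq τ e hx _ (star4_swap τ e hx _) Θ ρ fun μ α β ↦ ?_
  rw [← hpost.cyclic e x hx]
  have h : ∀ μ α β, lower4 g e (star4 τ e (star4 τ e (D.curv e))) x ρ μ α β
      = lower4 g e (D.curv e) x μ ρ α β := fun μ α β ↦ by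
    rw [D.lower4_curv_antisymm e hx]
    simp [lower4, star4_star4 τ e hx _ (D.curv_swap e x)]
  simp only [h]

/-- The Ricci tensor is `T`, by the cyclic identity for `R^⋆`. -/
theorem ricci_eq {τ : VolumeForm g} {D : MetricConnection g}
    {T Θ : TwoTensor M} (hpost : PostulatedEquations τ D T Θ) (e : MovingFrame M) {x : M}
    (hx : x ∈ e.dom) (μ : Fin 4) : ricci (D.curv e) x μ = TwoTensor.down T e x μ :=
  ricci_eq_of_cyc3_eq τ e hx _ (D.curv_swap e x) T μ (hpost.dualCyclic e x hx μ)

end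

theorem mainTheorem4 {M : Type*} [TopologicalSpace M] [T2Space M] [ChartedSpace E4 M]
    [IsManifold (𝓡 4) ∞ M] (g : LorentzMetric M) (τ : VolumeForm g) (D : MetricConnection g)
    (T Θ : TwoTensor M) (hpost : PostulatedEquations τ D T Θ) :
    (∀ (e : MovingFrame M), ∀ x ∈ e.dom,
      scalar g e (D.curv e) x = 0 ∧
      TwoTensor.trace g T e x = 0 ∧
      (∀ μ ρ α β, epsMixed τ Θ e x μ α β ρ = torsionSide D e (D.tor e) x μ ρ α β) ∧
      (∀ β α μ ν ρ, torsionCurvatureSide g e (D.tor e) (D.curv e) x β α μ ν ρ = 0)) ∧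
    ∀ (D' : MetricConnection g) (T' : TwoTensor M),
      IsDualConnection τ D D' → EinsteinEquation D' T' →
      (∀ (e : MovingFrame M), ∀ x ∈ e.dom, ∀ μ ρ l σ,
        epsMixed τ T' e x ρ l σ μ + 1 / 2 * TwoTensor.trace g T' e x * τ.eps e x μ ρ l σ
          = epsMixed τ Θ e x ρ l σ μ) ∧
      ∀ s : ℝ, s = 1 ∨ s = -1 → DualEquations τ D D' s T Θ →
        ∀ (e : MovingFrame M), ∀ x ∈ e.dom,
          scalar g e (star4 τ e (D.curv e)) x = 0 ∧
          (∀ μ κ, TwoTensor.mixed g T' e x μ κ = TwoTensor.mixed g Θ e x μ κ) ∧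
          TwoTensor.trace g T e x = 0 ∧
          TwoTensor.trace g Θ e x = 0 ∧
          (∀ μ ρ α β, epsMixed τ Θ e x μ α β ρ = torsionSide D e (D.tor e) x μ ρ α β) ∧
          (∀ μ ρ α β, s * epsMixed τ T e x μ α β ρ
            = torsionSide D' e (star3 τ e (D.tor e)) x μ ρ α β) ∧
          (∀ β α μ ν ρ, torsionCurvatureSide g e (D.tor e) (D.curv e) x β α μ ν ρ = 0) ∧
          (∀ β α μ ν ρ, torsionCurvatureSide g e (star3 τ e (D.tor e))
            (star4 τ e (D.curv e)) x β α μ ν ρ = 0) := by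
  have part1 : ∀ (e : MovingFrame M), ∀ x ∈ e.dom,
      scalar g e (D.curv e) x = 0 ∧
      TwoTensor.trace g T e x = 0 ∧
      (∀ μ ρ α β, epsMixed τ Θ e x μ α β ρ = torsionSide D e (D.tor e) x μ ρ α β) ∧
      (∀ β α μ ν ρ, torsionCurvatureSide g e (D.tor e) (D.curv e) x β α μ ν ρ = 0) := by
    intro e x hx
    have hR := ricci_eq hpost e hx
    have h0 : scalar g e (D.curv e) x = 0 := scalar_eq_zero_of_einstein_eq_ricci e hx _
      fun μ ν ↦ by rw [hpost.einsteinEq e x hx, hR]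
    refine ⟨h0, (scalar_eq_trace e _ T hR).symm.trans h0, fun μ ρ α β ↦ ?_, fun β α μ ν ρ ↦ ?_⟩
    · rw [← hpost.cyclic e x hx, D.first_bianchi_components e hx]
    · rw [← D.second_bianchi_components e hx, hpost.differential e x hx]
  refine ⟨part1, fun D' T' hdual hein ↦ ?_⟩
  have hdown : ∀ (e : MovingFrame M), ∀ x ∈ e.dom, ∀ μ ν, TwoTensor.down T' e x μ ν
      = TwoTensor.down Θ e x μ ν
        - 1 / 2 * g.down e x μ ν * scalar g e (star4 τ e (D.curv e)) x := by
    intro e x hx μ ν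
    rw [← hein e x hx, ← ricci_star4_eq hpost e hx]
    simp only [einstein, scalar, ricci, hdual.curvature e x hx]
  refine ⟨fun e x hx μ ρ l σ ↦ ?_, fun s _ hde e x hx ↦ ?_⟩
  · obtain ⟨hm, ht⟩ := mixed_and_trace_of_down_eq e hx T' Θ _ (hdown e x hx)
    -- `ht` becomes `T'_κ^κ = R^⋆ - 2 R^⋆`.
    rw [← scalar_eq_trace e _ Θ (ricci_star4_eq hpost e hx)] at ht
    have hl : (levi μ ρ l σ : ℝ) = -levi ρ l σ μ := by exact_mod_cast levi_rotate ρ l σ μ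
    simp only [epsMixed, hm, ht, mul_sub, Finset.sum_sub_distrib, mul_ite, mul_one, mul_zero,
      Finset.sum_ite_eq, Finset.mem_univ, if_true]
    rw [τ.eps_eq e hx μ, τ.eps_eq e hx ρ l σ μ, hl]
    ring
  · have hR := ricci_star4_eq hpost e hx
    have h0 : scalar g e (star4 τ e (D.curv e)) x = 0 :=
      scalar_eq_zero_of_einstein_eq_ricci e hx _ fun μ ν ↦ by rw [hde.einsteinEq e x hx, hR]
    obtain ⟨hm, -⟩ := mixed_and_trace_of_down_eq e hx T' Θ _ (hdown e x hx)
    obtain ⟨-, hT, hB1, hB2⟩ := part1 e x hx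
    -- The starred components are those of `D'` on all of the domain, hence so are their
    -- covariant derivatives.
    have hl3 : ∀ y ∈ e.dom, lower3 g e (star3 τ e (D.tor e)) y = lower3 g e (D'.tor e) y := by
      intro y hy
      ext ρ α β
      simp only [lower3, hdual.torsion e y hy]
    have hl4 : ∀ y ∈ e.dom, lower4 g e (star4 τ e (D.curv e)) y = lower4 g e (D'.curv e) y := by
      intro y hy
      ext μ ρ α β
      simp only [lower4, hdual.curvature e y hy]
    have hnhds := e.isOpen_dom.mem_nhds hx
    have hc3 : ∀ μ ρ α β, D'.cov3 e (lower3 g e (star3 τ e (D.tor e))) x μ ρ α β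
        = D'.cov3 e (lower3 g e (D'.tor e)) x μ ρ α β := fun μ ρ α β ↦ by
      have := mvfderiv_congr (f := fun y ↦ lower3 g e (star3 τ e (D.tor e)) y ρ α β)
        (f' := fun y ↦ lower3 g e (D'.tor e) y ρ α β) (x := x)
        (by filter_upwards [hnhds] with y hy using by rw [hl3 y hy])
      simp only [MetricConnection.cov3, this, hl3 x hx]
    have hc4 : ∀ μ β α ν ρ, D'.cov4 e (lower4 g e (star4 τ e (D.curv e))) x μ β α ν ρ
        = D'.cov4 e (lower4 g e (D'.curv e)) x μ β α ν ρ := fun μ β α ν ρ ↦ by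
      have := mvfderiv_congr (f := fun y ↦ lower4 g e (star4 τ e (D.curv e)) y β α ν ρ)
        (f' := fun y ↦ lower4 g e (D'.curv e) y β α ν ρ) (x := x)
        (by filter_upwards [hnhds] with y hy using by rw [hl4 y hy])
      simp only [MetricConnection.cov4, this, hl4 x hx]
    refine ⟨h0, fun μ κ ↦ by rw [hm, h0]; ring, hT,
      (scalar_eq_trace e _ Θ hR).symm.trans h0, hB1, fun μ ρ α β ↦ ?_, hB2, fun β α μ ν ρ ↦ ?_⟩
    · rw [← hde.cyclic e x hx]
      have h := D'.first_bianchi_components e hx μ ρ α β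
      simp only [torsionSide, hc3, hl3 x hx, hl4 x hx, ← hdual.torsion e x hx] at h ⊢
      exact h
    · rw [← hde.differential e x hx β α μ ν ρ]
      have h := D'.second_bianchi_components e hx β α μ ν ρ
      simp only [torsionCurvatureSide, hc4, hl4 x hx, ← hdual.torsion e x hx] at h ⊢
      exact h.symm
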